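/- **Model.** A unit mass of students attends infinitesimally small schools of finitely many types $i\in I$; type $i$ has a share $w_i>0$ of the students ($\sum_i w_i=1$), whose abilities have a distribution $F_i$ on $[0,1]$. There is a unit mass of jobs, whose qualities have a distribution $\mu$ with a positive density on $[0,1]$. A transcript structure for type $i$ is a (possibly randomized) map from true abilities to grades such that the mean true ability of the students of the school who receive grade $\hat a$ is $\hat a$; let $G_i$ be the resulting distribution of grades and $G=\sum_i w_iG_i$. Students are matched to jobs monotonically in their grades (ties are broken uniformly at random); the desirability mapping $Q(\hat a)$ is the expected quality of the job matched with a student of grade $\hat a$. A profile of transcript structures is an equilibrium if, for every type $i$, $\int_0^1 Q\,dG_i\ge\int_0^1 Q\,d\hat G_i$ for the grade distribution $\hat G_i$ of every alternative transcript structure of type $i$, with $Q$ kept fixed. It is connected if every point strictly between the lowest and the highest grade produced has a neighbourhood all of whose points are grades produced by the schools of a single type. The welfare of a profile is the expected value of $aq$, where $a$ is the true ability of a random student and $q$ is the quality of the job he is matched with; the truthful profile is the one in which every grade equals the true ability. The price of anarchy is the supremum, over the connected equilibria, of the ratio of the welfare of the truthful profile to the welfare of the equilibrium. **Theorem.** If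 the aggregate ability distribution $\sum_i w_iF_i$ is uniform on $[0,1]$, then the price of anarchy of the strategic grading game is at most $1.36$. -/

import Mathlib

open MeasureTheory ProbabilityTheory Set
open scoped NNReal ENNReal

noncomputable section

namespace Grading

/-- The primitives of the grading game with finitely many types of (infinitesimally small) schools.
Job qualities have a distribution on `[0,1]` with a positive density; schools of type `i` hold a
fraction `weight i` of the unit mass of students, and the true abilities of their students are
distributed on `[0,1]` according to `ability i`. The mass of jobs equals the mass of students. -/
structure Market (ι : Type*) [Fintype ι] where
  jobDensity : ℝ → ℝ≥0∞
  measurable_jobDensity : Measurable jobDensity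
  jobDensity_pos : ∀ q ∈ Icc (0 : ℝ) 1, 0 < jobDensity q
  lintegral_jobDensity : ∫⁻ q in Icc (0 : ℝ) 1, jobDensity q = 1
  weight : ι → ℝ≥0
  weight_pos : ∀ i, 0 < weight i
  sum_weight : ∑ i, weight i = 1
  ability : ι → Measure ℝ
  ability_prob : ∀ i, IsProbabilityMeasure (ability i)
  ability_supp : ∀ i, ∀ᵐ a ∂(ability i), a ∈ Icc (0 : ℝ) 1

/-- A transcript structure for a school with ability distribution `F`: a Markov kernel from true
abilities to grades, a grade being identified with the expected ability that it reveals, i.e.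
`E[true ability | grade] = grade` under the joint law of (true ability, grade).
(As `F` lives on `[0,1]`, so do almost all grades.) -/
structure IsTranscript (F : Measure ℝ) (κ : Kernel ℝ ℝ) : Prop where
  markov : IsMarkovKernel κ
  calibrated :
    (F ⊗ₘ κ)[Prod.fst | MeasurableSpace.comap Prod.snd inferInstance] =ᵐ[F ⊗ₘ κ] Prod.snd

/-- The distribution of the grades in a school with ability distribution `F` that uses `κ`. -/
def gradeDist (F : Measure ℝ) (κ : Kernel ℝ ℝ) : Measure ℝ := (F ⊗ₘ κ).map Prod.snd

/-- When grades have the distribution `G`, a student with grade `x` occupies a rank between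
`G(x-)` and `G(x)`; `t ∈ [0,1]` is the (uniform) tie-breaker among students of equal grade. -/
def rank (G : Measure ℝ) (x t : ℝ) : ℝ := (1 - t) * G.real (Iio x) + t * G.real (Iic x)

namespace Market

variable {ι : Type*} [Fintype ι] (M : Market ι)

/-- The distribution of job qualities. -/
def jobs : Measure ℝ := (volume.restrict (Icc 0 1)).withDensity M.jobDensity

/-- The aggregate distribution of true abilities. -/
def aggregateAbility : Measure ℝ := ∑ i, M.weight i • M.ability i

/-- The quality of the job of rank `u ∈ [0,1]` (the quantile function of the job qualities). -/
def jobQuantile (u : ℝ) : ℝ := sInf {q ∈ Icc (0 : ℝ) 1 | u ≤ M.jobs.real (Iic q)}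

/-- A profile assigns a transcript structure to each type of schools. -/
def IsProfile (φ : ι → Kernel ℝ ℝ) : Prop := ∀ i, IsTranscript (M.ability i) (φ i)

/-- The aggregate distribution of expected abilities (grades) under the profile `φ`. -/
def aggregateGrade (φ : ι → Kernel ℝ ℝ) : Measure ℝ :=
  ∑ i, M.weight i • gradeDist (M.ability i) (φ i)

/-- The desirability mapping: the expected quality of the job matched with a student of grade `x`,
when higher grades are matched with better jobs. -/
def desirability (φ : ι → Kernel ℝ ℝ) (x : ℝ) : ℝ :=
  ∫ t in (0 : ℝ)..1, M.jobQuantile (rank (M.aggregateGrade φ) x t)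

/-- `φ` is an equilibrium: no school can improve the average placement of its students by another
transcript structure, the desirability mapping being kept fixed (schools are infinitesimal). -/
def IsEquilibrium (φ : ι → Kernel ℝ ℝ) : Prop :=
  M.IsProfile φ ∧ ∀ i, ∀ κ : Kernel ℝ ℝ, IsTranscript (M.ability i) κ →
    ∫ x, M.desirability φ x ∂(gradeDist (M.ability i) κ) ≤
      ∫ x, M.desirability φ x ∂(gradeDist (M.ability i) (φ i))

/-- Every point strictly between the lowest and the highest grade produced under `φ` has a
neighbourhood all of whose points are grades produced by the schools of one and the same type. -/
def IsConnected (φ : ι → Kernel ℝ ℝ) : Prop :=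
  ∀ x ∈ Ioo (sInf (M.aggregateGrade φ).support) (sSup (M.aggregateGrade φ).support),
    ∃ i, ∃ ε > 0, Ioo (x - ε) (x + ε) ⊆ (gradeDist (M.ability i) (φ i)).support

/-- The social welfare of the matching resulting from `φ`: the expected value of `f q * g a`, where
`a` is the true ability of a random student and `q` is the quality of the job he is matched with. -/
def welfare (f g : ℝ → ℝ) (φ : ι → Kernel ℝ ℝ) : ℝ :=
  ∑ i, (M.weight i : ℝ) * ∫ p, g p.1 *
      (∫ t in (0 : ℝ)..1, f (M.jobQuantile (rank (M.aggregateGrade φ) p.2 t)))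
    ∂(M.ability i ⊗ₘ φ i)

/-- The welfare of the truthful mapping, in which every school reveals the true abilities. -/
def truthfulWelfare (f g : ℝ → ℝ) : ℝ := M.welfare f g fun _ => Kernel.id

/-- The price of anarchy of the strategic grading game: the largest ratio of the welfare of the
truthful mapping to that of a connected equilibrium (the ratio is `∞` when the denominator is not
positive and the numerator is). -/
def priceOfAnarchy (f g : ℝ → ℝ) : ℝ≥0∞ :=
  ⨆ (φ : ι → Kernel ℝ ℝ) (_ : M.IsEquilibrium φ) (_ : M.IsConnected φ),
    ENNReal.ofReal (M.truthfulWelfare f g) / ENNReal.ofReal (M.welfare f g φ)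

end Market

end Grading

end

/-
Replacing a set of students of one school by a single grade, their average ability, is a deviation
available to every school. It yields three facts about the desirability `Q` of a connected
equilibrium with grade distribution `G`.
* `G` has no atom: pooling an atom without a few of its worst students lifts all the others
  across the jump of `Q`.
* `Q` is convex up to the top grade `b`: around an interior grade, pooling two small groups of
  grades symmetric about it would be profitable if midpoint convexity failed.
* If abilities exceed `b`, pooling all abilities above a threshold `t` with mean `b` is only
  unprofitable if `Q` is affine on `[t, b]`.

Hence `Q` extends affinely beyond `b` to a convex monotone `P` on `[0, 1]` with
`∫ P dF ≤ ∫ P dG`, where `F` is uniform. With `Φ u = ∫_{1/2}^u P`, the truthful welfare exceeds the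
equilibrium welfare `W` by at most `∫ Φ dF ≤ 0.18 ∫ P dF ≤ 0.18 ∫ P dG ≤ 0.36 W`; the last step is
Chebyshev's inequality, as `G` has mean `1/2`.
-/

namespace Grading

open Filter Topology

section Convexity

lemma nonpos_of_frequently_midpoint_le {D : ℝ → ℝ} {y z : ℝ} (hD : ContinuousOn D (Icc y z))
    (hy : D y ≤ 0) (hz : D z ≤ 0)
    (hmid : ∀ x ∈ Ioo y z, ∃ᶠ δ in 𝓝[>] 0, 2 * D x ≤ D (x - δ) + D (x + δ)) :
    ∀ x ∈ Icc y z, D x ≤ 0 := by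
  intro w hw
  obtain ⟨m, hm, hmax⟩ := isCompact_Icc.exists_isMaxOn ⟨w, hw⟩ hD
  refine (hmax hw).trans (not_lt.1 fun hpos => ?_)
  -- at the leftmost maximum the midpoint inequality is violated
  have hne : (Icc y z ∩ D ⁻¹' {D m}).Nonempty := ⟨m, hm, rfl⟩
  have hbdd : BddBelow (Icc y z ∩ D ⁻¹' {D m}) := ⟨y, fun x hx => hx.1.1⟩
  obtain ⟨hx, hDx⟩ :=
    (hD.preimage_isClosed_of_isClosed isClosed_Icc isClosed_singleton).csInf_mem hne hbdd
  set x := sInf (Icc y z ∩ D ⁻¹' {D m})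
  replace hDx : D x = D m := hDx
  have hyx : y < x := hx.1.lt_of_ne fun e => by rw [← e] at hDx; linarith
  have hxz : x < z := hx.2.lt_of_ne fun e => by rw [e] at hDx; linarith
  obtain ⟨δ, hmidδ, hδ0, hδ⟩ := ((hmid x ⟨hyx, hxz⟩).and_eventually
    (Ioo_mem_nhdsGT (lt_min (sub_pos.2 hyx) (sub_pos.2 hxz)))).exists
  obtain ⟨hδy, hδz⟩ := lt_min_iff.1 hδ
  have hright : D (x + δ) ≤ D m := hmax ⟨by linarith, by linarith⟩
  have hleft : D (x - δ) < D m := by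
    refine lt_of_le_of_ne (hmax ⟨by linarith, by linarith⟩) fun e => ?_
    have : x ≤ x - δ := csInf_le hbdd ⟨⟨by linarith, by linarith⟩, e⟩
    linarith
  linarith

lemma convexOn_of_frequently_midpoint_le {s : Set ℝ} {Q : ℝ → ℝ} (hs : Convex ℝ s)
    (hQ : ContinuousOn Q s)
    (hmid : ∀ x ∈ interior s, ∃ᶠ δ in 𝓝[>] 0, 2 * Q x ≤ Q (x - δ) + Q (x + δ)) :
    ConvexOn ℝ s Q := by
  refine LinearOrder.convexOn_of_lt hs fun y hy z hz hyz a b ha hb hab => ?_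
  obtain rfl : a = 1 - b := by linarith
  set r := slope Q y z
  have hr : r * (z - y) = Q z - Q y := by
    simpa [mul_comm] using sub_smul_slope Q y z
  have hsub : Icc y z ⊆ s := hs.ordConnected.out hy hz
  have hD := nonpos_of_frequently_midpoint_le (D := fun x => Q x - (Q y + r * (x - y)))
    ((hQ.mono hsub).sub (by fun_prop)) (by simp) (by simp [hr])
    (fun x hx => (hmid x (interior_mono hsub (by rwa [interior_Icc]))).mono
      fun δ hδ => by linarith) ((1 - b) * y + b * z)
    ⟨by nlinarith, by nlinarith⟩
  simp only [smul_eq_mul]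
  linear_combination hD + b * hr

variable {Q : ℝ → ℝ} {S : Set ℝ} {b s t x y z : ℝ}

lemma le_secant_of_mem_Icc (hQ : ConvexOn ℝ S Q) (hy : y ∈ S) (hz : z ∈ S) (hyx : y ≤ x)
    (hxz : x ≤ z) : Q x ≤ Q y + slope Q y z * (x - y) := by
  rcases hyx.eq_or_lt with rfl | hyx
  · simp
  have hx : x ∈ S := hQ.1.ordConnected.out hy hz ⟨hyx.le, hxz⟩
  have hle : slope Q y x ≤ slope Q y z :=
    hQ.slope_mono hy ⟨hx, hyx.ne'⟩ ⟨hz, (hyx.trans_le hxz).ne'⟩ hxz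
  have hslope : (x - y) * slope Q y x = Q x - Q y := sub_smul_slope Q y x
  nlinarith

lemma secant_le_of_le_left (hQ : ConvexOn ℝ S Q) (hx : x ∈ S) (hy : y ∈ S) (hz : z ∈ S)
    (hxy : x ≤ y) (hyz : y < z) : Q y + slope Q y z * (x - y) ≤ Q x := by
  rcases hxy.eq_or_lt with rfl | hxy
  · simp
  have hle : slope Q y x ≤ slope Q y z :=
    hQ.slope_mono hy ⟨hx, hxy.ne⟩ ⟨hz, hyz.ne'⟩ (hxy.trans hyz).le
  have hslope : (x - y) * slope Q y x = Q x - Q y := sub_smul_slope Q y x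
  nlinarith

lemma secant_le_of_le_right (hQ : ConvexOn ℝ S Q) (hx : x ∈ S) (hy : y ∈ S) (hz : z ∈ S)
    (hyz : y < z) (hzx : z ≤ x) : Q y + slope Q y z * (x - y) ≤ Q x := by
  have hyx := hyz.trans_le hzx
  have hle : slope Q y z ≤ slope Q y x := hQ.slope_mono hy ⟨hz, hyz.ne'⟩ ⟨hx, hyx.ne'⟩ hzx
  have hslope : (x - y) * slope Q y x = Q x - Q y := sub_smul_slope Q y x
  nlinarith

/-- The function that agrees with `Q` up to `t` and continues with slope `s` from there. -/
def extendLine (Q : ℝ → ℝ) (t s x : ℝ) : ℝ := Q (min x t) + s * (x - min x t)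

lemma extendLine_of_le (hx : x ≤ t) : extendLine Q t s x = Q x := by
  simp [extendLine, hx]

lemma extendLine_of_ge (hx : t ≤ x) : extendLine Q t s x = Q t + s * (x - t) := by
  simp [extendLine, hx]

lemma continuous_extendLine (hQ : Continuous Q) (t s : ℝ) : Continuous (extendLine Q t s) := by
  unfold extendLine
  fun_prop

lemma monotone_extendLine (hQ : Monotone Q) (t : ℝ) (hs : 0 ≤ s) :
    Monotone (extendLine Q t s) := by
  intro x y hxy
  have : x - min x t ≤ y - min y t := by grind
  unfold extendLine
  gcongr
  exact hQ (min_le_min_right t hxy)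

lemma antitoneOn_sub_slope_mul (hQ : ConvexOn ℝ (Iic b) Q) (htz : t < z) (hzb : z ≤ b) :
    AntitoneOn (fun x => Q x - slope Q t z * x) (Iic t) := by
  intro x hx y hy hxy
  rcases hxy.eq_or_lt with rfl | hxy
  · rfl
  have htb : t ≤ b := htz.le.trans hzb
  have hx' : x ∈ Iic b := le_trans hx htb
  have hy' : y ∈ Iic b := le_trans hy htb
  have h₁ : slope Q x y ≤ slope Q x z := hQ.slope_mono hx' ⟨hy', hxy.ne'⟩
    ⟨hzb, (hxy.trans (lt_of_le_of_lt hy htz)).ne'⟩ (le_trans hy htz.le)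
  have h₂ : slope Q z x ≤ slope Q z t := hQ.slope_mono hzb
    ⟨hx', (lt_of_le_of_lt hx htz).ne⟩ ⟨htb, htz.ne⟩ hx
  rw [slope_comm, slope_comm Q z] at h₂
  have h₃ : (y - x) * slope Q x y = Q y - Q x := sub_smul_slope Q x y
  have h₄ := mul_le_mul_of_nonneg_left (h₁.trans h₂) (sub_nonneg.2 hxy.le)
  simp only
  linarith

lemma convexOn_extendLine_slope (hQ : ConvexOn ℝ (Iic b) Q) (htz : t < z) (hzb : z ≤ b) :
    ConvexOn ℝ univ (extendLine Q t (slope Q t z)) := by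
  set s := slope Q t z
  -- the function is `x ↦ H (min x t) + s * x` with `H` convex and antitone
  have hmin : ConcaveOn ℝ univ fun x : ℝ => min x t :=
    (concaveOn_id convex_univ).inf (concaveOn_const t convex_univ)
  have himage : (fun x => min x t) '' univ = Iic t := by
    ext y
    simp only [image_univ, mem_range, mem_Iic]
    exact ⟨by rintro ⟨x, rfl⟩; exact min_le_right x t, fun hy => ⟨y, min_eq_left hy⟩⟩
  have hH : ConvexOn ℝ (Iic t) fun x => Q x + -(s * x) :=
    (hQ.subset (Iic_subset_Iic.2 (htz.le.trans hzb)) (convex_Iic t)).add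
      ((LinearMap.mulLeft ℝ s).concaveOn (convex_Iic t)).neg
  have hcomp := (himage ▸ hH).comp_concaveOn hmin
    (himage ▸ by simpa only [← sub_eq_add_neg] using antitoneOn_sub_slope_mul hQ htz hzb)
  refine (hcomp.add ((LinearMap.mulLeft ℝ s).convexOn convex_univ)).congr fun x _ => ?_
  simp only [extendLine, Pi.add_apply, Function.comp_apply, LinearMap.mulLeft_apply]
  ring

lemma extendLine_slope_right (htb : t < b) : extendLine Q t (slope Q t b) b = Q b := by
  have : (b - t) * slope Q t b = Q b - Q t := sub_smul_slope Q t b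
  rw [extendLine_of_ge htb.le]
  linarith

lemma le_extendLine_slope (hQ : ConvexOn ℝ (Iic b) Q) (htb : t < b) (hx : x ≤ b) :
    Q x ≤ extendLine Q t (slope Q t b) x := by
  rcases le_or_gt x t with hxt | htx
  · exact (extendLine_of_le hxt).ge
  rw [extendLine_of_ge htx.le]
  exact le_secant_of_mem_Icc hQ (mem_Iic.2 htb.le) self_mem_Iic htx.le hx

lemma extendLine_slope_eq_of_eq (hQ : ConvexOn ℝ (Iic b) Q) {w : ℝ} (htw : t < w) (hwb : w < b)
    (hw : extendLine Q t (slope Q t b) w = Q w) (hx : x ≤ b) :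
    extendLine Q t (slope Q t b) x = Q x := by
  refine le_antisymm (not_lt.1 fun hlt => ?_) (le_extendLine_slope hQ (htw.trans hwb) hx)
  have htx : t < x := not_le.1 fun hxt => by rw [extendLine_of_le hxt] at hlt; exact hlt.false
  have hb := extendLine_slope_right (Q := Q) (htw.trans hwb)
  rw [extendLine_of_ge (htw.trans hwb).le] at hb
  rw [extendLine_of_ge htw.le] at hw
  rw [extendLine_of_ge htx.le] at hlt
  set s := slope Q t b
  have hD : ConvexOn ℝ (Iic b) fun x => Q x + -(s * x) :=
    hQ.add ((LinearMap.mulLeft ℝ s).concaveOn (convex_Iic b)).neg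
  rcases lt_trichotomy x w with hxw | rfl | hwx
  · have := hD.lt_right_of_left_lt (x := x) (y := b) (z := w) hx self_mem_Iic
      (by rw [openSegment_eq_Ioo (hxw.trans hwb)]; exact ⟨hxw, hwb⟩) (by linarith)
    linarith
  · exact hlt.ne hw.symm
  · have := hD.lt_left_of_right_lt (x := t) (y := x) (z := w) (mem_Iic.2 (htw.trans hwb).le) hx
      (by rw [openSegment_eq_Ioo htx]; exact ⟨htw, hwx⟩) (by linarith)
    linarith

lemma extendLine_eq_of_affineOn (htb : t ≤ b)
    (h : ∀ x ∈ Icc t b, Q x = Q b + s * (x - b)) : extendLine Q b s = extendLine Q t s := by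
  have ht := h t (left_mem_Icc.2 htb)
  ext x
  rcases le_total x b with hxb | hbx
  · rw [extendLine_of_le hxb]
    rcases le_total x t with hxt | htx
    · rw [extendLine_of_le hxt]
    · rw [extendLine_of_ge htx, h x ⟨htx, hxb⟩]
      linarith
  · rw [extendLine_of_ge hbx, extendLine_of_ge (htb.trans hbx)]
    linarith

end Convexity

section AntiderivativeBound

variable {P : ℝ → ℝ}

lemma integral_integral_eq (hc : Continuous P) (a h b : ℝ) :
    ∫ u in a..b, ∫ x in h..u, P x = (∫ x in h..b, (b - x) * P x) - ∫ x in a..h, (x - a) * P x := by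
  set Φ : ℝ → ℝ := fun u => ∫ x in h..u, P x
  have hΦ : ∀ u, HasDerivAt Φ (P u) u := fun u =>
    (hc.integral_hasStrictDerivAt h u).hasDerivAt
  have hΦc : Continuous Φ := continuous_iff_continuousAt.2 fun u => (hΦ u).continuousAt
  have hparts : ∀ c d e : ℝ, ∫ u in c..d, Φ u =
      (d - e) * Φ d - (c - e) * Φ c - ∫ u in c..d, (u - e) * P u := fun c d e => by
    have := intervalIntegral.integral_mul_deriv_eq_deriv_mul (a := c) (b := d)
      (fun x _ => (hasDerivAt_id x).sub_const e) (fun x _ => hΦ x)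
      intervalIntegrable_const (hc.intervalIntegrable _ _)
    simp only [id, one_mul] at this
    linarith
  have hΦh : Φ h = 0 := intervalIntegral.integral_same
  have hneg : ∫ x in h..b, (b - x) * P x = -∫ x in h..b, (x - b) * P x := by
    rw [← intervalIntegral.integral_neg]
    exact intervalIntegral.integral_congr fun x _ => by ring
  rw [← intervalIntegral.integral_add_adjacent_intervals (hΦc.intervalIntegrable a h)
    (hΦc.intervalIntegrable h b), hparts a h a, hparts h b b, hΦh, hneg]
  ring

lemma integral_quadratic (a b α β γ : ℝ) : ∫ x in a..b, (α + β * x + γ * x ^ 2) =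
    α * (b - a) + β * ((b ^ 2 - a ^ 2) / 2) + γ * ((b ^ 3 - a ^ 3) / 3) := by
  have hi : ∀ f : ℝ → ℝ, Continuous f → IntervalIntegrable f volume a b :=
    fun f hf => hf.intervalIntegrable a b
  rw [intervalIntegral.integral_add (hi _ (by fun_prop)) (hi _ (by fun_prop)),
    intervalIntegral.integral_add (hi _ (by fun_prop)) (hi _ (by fun_prop)),
    intervalIntegral.integral_const, intervalIntegral.integral_const_mul,
    intervalIntegral.integral_const_mul, integral_id, integral_pow]
  norm_num
  ring

lemma half_mem_Icc : (1 / 2 : ℝ) ∈ Icc (0 : ℝ) 1 := by norm_num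

-- The weights `0.82 - x` and, on `[0, 1/2]`, `x + 0.18` are `1 - x` and `x` after moving `0.18 ∫ P`
-- across. The secant of `P` through `1/2` and `0.82` changes sides where the weight changes sign.
lemma integral_right_le (hc : Continuous P) (hP : ConvexOn ℝ (Icc 0 1) P) :
    ∫ x in (1 / 2 : ℝ)..1, (0.82 - x) * P x ≤
      0.035 * P (1 / 2) - slope P (1 / 2) 0.82 / 600 := by
  set r := P (1 / 2)
  set c := slope P (1 / 2) 0.82
  have hz : (0.82 : ℝ) ∈ Icc (0 : ℝ) 1 := by norm_num
  calc ∫ x in (1 / 2 : ℝ)..1, (0.82 - x) * P x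
    _ ≤ ∫ x in (1 / 2 : ℝ)..1, (0.82 - x) * (r + c * (x - 1 / 2)) := by
        refine intervalIntegral.integral_mono_on (by norm_num)
          (Continuous.intervalIntegrable (by fun_prop) _ _)
          (Continuous.intervalIntegrable (by fun_prop) _ _) fun x hx => ?_
        rcases le_total x 0.82 with hx' | hx'
        · exact mul_le_mul_of_nonneg_left
            (le_secant_of_mem_Icc hP half_mem_Icc hz hx.1 hx') (by linarith)
        · exact mul_le_mul_of_nonpos_left (secant_le_of_le_right hP
            ⟨by linarith [hx.1], hx.2⟩ half_mem_Icc hz (by norm_num) hx') (by linarith)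
    _ = ∫ x in (1 / 2 : ℝ)..1,
          (0.82 * (r - c / 2) + (0.82 * c - (r - c / 2)) * x + -c * x ^ 2) :=
        intervalIntegral.integral_congr fun x _ => by ring
    _ = 0.035 * r - c / 600 := by
        rw [integral_quadratic]
        ring

-- On `[0, 0.44]`, where the secant may be negative, `0 ≤ P` is used instead.
lemma le_integral_left (hc : Continuous P) (h0 : ∀ x ∈ Icc (0 : ℝ) 1, 0 ≤ P x)
    (hP : ConvexOn ℝ (Icc 0 1) P) :
    0.039 * P (1 / 2) - 0.001152 * slope P (1 / 2) 0.82 ≤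
      ∫ x in (0 : ℝ)..1 / 2, (x + 0.18) * P x := by
  set r := P (1 / 2)
  set c := slope P (1 / 2) 0.82
  have hi : ∀ a b : ℝ, IntervalIntegrable (fun x => (x + 0.18) * P x) volume a b :=
    fun a b => Continuous.intervalIntegrable (by fun_prop) a b
  calc 0.039 * r - 0.001152 * c
    _ = ∫ x in (0.44 : ℝ)..1 / 2,
          (0.18 * (r - c / 2) + (0.18 * c + (r - c / 2)) * x + c * x ^ 2) := by
        rw [integral_quadratic]
        ring
    _ = ∫ x in (0.44 : ℝ)..1 / 2, (x + 0.18) * (r + c * (x - 1 / 2)) :=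
        intervalIntegral.integral_congr fun x _ => by ring
    _ ≤ ∫ x in (0.44 : ℝ)..1 / 2, (x + 0.18) * P x := by
        refine intervalIntegral.integral_mono_on (by norm_num)
          (Continuous.intervalIntegrable (by fun_prop) _ _) (hi _ _) fun x hx => ?_
        exact mul_le_mul_of_nonneg_left (secant_le_of_le_left hP
          ⟨by linarith [hx.1], by linarith [hx.2]⟩ half_mem_Icc (by norm_num) hx.2 (by norm_num))
          (by linarith [hx.1])
    _ ≤ (∫ x in (0 : ℝ)..0.44, (x + 0.18) * P x) + ∫ x in (0.44 : ℝ)..1 / 2, (x + 0.18) * P x :=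
        le_add_of_nonneg_left <| intervalIntegral.integral_nonneg (by norm_num) fun x hx =>
          mul_nonneg (by linarith [hx.1]) (h0 x ⟨hx.1, by linarith [hx.2]⟩)
    _ = ∫ x in (0 : ℝ)..1 / 2, (x + 0.18) * P x :=
        intervalIntegral.integral_add_adjacent_intervals (hi _ _) (hi _ _)

lemma integral_antiderivative_le (hc : Continuous P) (h0 : ∀ x ∈ Icc (0 : ℝ) 1, 0 ≤ P x)
    (hmono : Monotone P) (hP : ConvexOn ℝ (Icc 0 1) P) :
    ∫ u in (0 : ℝ)..1, ∫ x in (1 / 2 : ℝ)..u, P x ≤ 0.18 * ∫ x in (0 : ℝ)..1, P x := by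
  have hi : ∀ {f : ℝ → ℝ}, Continuous f → ∀ a b, IntervalIntegrable f volume a b :=
    fun hf a b => hf.intervalIntegrable a b
  have hright : ∫ x in (1 / 2 : ℝ)..1, (0.82 - x) * P x =
      (∫ x in (1 / 2 : ℝ)..1, (1 - x) * P x) - 0.18 * ∫ x in (1 / 2 : ℝ)..1, P x := by
    rw [← intervalIntegral.integral_const_mul,
      ← intervalIntegral.integral_sub (hi (by fun_prop) _ _) (hi (by fun_prop) _ _)]
    exact intervalIntegral.integral_congr fun x _ => by ring
  have hleft : ∫ x in (0 : ℝ)..1 / 2, (x + 0.18) * P x =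
      (∫ x in (0 : ℝ)..1 / 2, (x - 0) * P x) + 0.18 * ∫ x in (0 : ℝ)..1 / 2, P x := by
    rw [← intervalIntegral.integral_const_mul,
      ← intervalIntegral.integral_add (hi (by fun_prop) _ _) (hi (by fun_prop) _ _)]
    exact intervalIntegral.integral_congr fun x _ => by ring
  have hr : 0 ≤ P (1 / 2) := h0 _ half_mem_Icc
  have hs : 0 ≤ slope P (1 / 2) 0.82 :=
    (hmono.monotoneOn univ).slope_nonneg (mem_univ _) (mem_univ _)
  rw [integral_integral_eq hc, ← intervalIntegral.integral_add_adjacent_intervals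
    (hi hc 0 (1 / 2)) (hi hc (1 / 2) 1)]
  linarith [integral_right_le hc hP, le_integral_left hc h0 hP]

end AntiderivativeBound

section Atomless

lemma continuous_measureReal_Iic (G : Measure ℝ) [IsFiniteMeasure G] [NullSingletonClass G] :
    Continuous fun x => G.real (Iic x) := by
  have hprim : Continuous fun x => ∫ _ in (0 : ℝ)..x, (1 : ℝ) ∂G :=
    intervalIntegral.continuous_primitive (fun _ _ => intervalIntegrable_const) 0
  refine (hprim.add (continuous_const (y := G.real (Iic 0)))).congr fun x => ?_
  rw [Pi.add_apply, ← intervalIntegral.integral_Iic_sub_Iic (integrable_const _).integrableOn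
    (integrable_const _).integrableOn]
  simp

lemma exists_measureReal_Iic_eq (G : Measure ℝ) [IsFiniteMeasure G] [NullSingletonClass G] {u : ℝ}
    (h0 : 0 < u) (h1 : u < G.real univ) : ∃ x, G.real (Iic x) = u := by
  have hbot : Tendsto (fun x => G.real (Iic x)) atBot (𝓝 0) := by
    have := tendsto_measure_iInter_atBot (μ := G) (s := Iic) (fun x => nullMeasurableSet_Iic)
      monotone_Iic ⟨0, measure_ne_top G _⟩
    rw [iInter_Iic_eq_empty_iff.2 (by simp [range_id', not_bddBelow_univ]), measure_empty] at this
    exact (ENNReal.tendsto_toReal ENNReal.zero_ne_top).comp this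
  have htop : Tendsto (fun x => G.real (Iic x)) atTop (𝓝 (G.real univ)) :=
    (ENNReal.tendsto_toReal (measure_ne_top G univ)).comp (tendsto_measure_Iic_atTop G)
  obtain ⟨a, ha⟩ := (hbot.eventually (gt_mem_nhds h0)).exists
  obtain ⟨b, hb⟩ := (htop.eventually (lt_mem_nhds h1)).exists
  exact mem_range_of_exists_le_of_exists_ge (continuous_measureReal_Iic G) ⟨a, ha.le⟩ ⟨b, hb.le⟩

lemma exists_subset_measureReal_eq {α : Type*} [MeasurableSpace α] {μ : Measure α}
    [IsFiniteMeasure μ] {X : α → ℝ} (hX : Measurable X) [NullSingletonClass (μ.map X)] {A : Set α}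
    (hA : MeasurableSet A) {m : ℝ} (hm : 0 ≤ m) (hmA : m ≤ μ.real A) :
    ∃ B ⊆ A, MeasurableSet B ∧ μ.real B = m := by
  rcases hm.eq_or_lt with rfl | hm
  · exact ⟨∅, empty_subset A, .empty, measureReal_empty⟩
  rcases hmA.eq_or_lt with rfl | hmA
  · exact ⟨A, Subset.rfl, hA, rfl⟩
  have : NullSingletonClass ((μ.restrict A).map X) :=
    ⟨fun x => (Measure.map_mono Measure.restrict_le_self hX).absolutelyContinuous
      (measure_singleton x)⟩
  obtain ⟨x, hx⟩ := exists_measureReal_Iic_eq ((μ.restrict A).map X) hm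
    (by simpa [map_measureReal_apply hX] using hmA)
  refine ⟨X ⁻¹' Iic x ∩ A, inter_subset_right, (hX measurableSet_Iic).inter hA, ?_⟩
  rwa [map_measureReal_apply hX measurableSet_Iic,
    measureReal_restrict_apply (hX measurableSet_Iic)] at hx

variable (G : Measure ℝ) [IsProbabilityMeasure G] [NullSingletonClass G]

lemma measureReal_setOf_measureReal_Iic_le {u : ℝ} (h0 : 0 ≤ u) (h1 : u < 1) :
    G.real {x | G.real (Iic x) ≤ u} = u := by
  have hmono : Monotone fun x => G.real (Iic x) := fun x y hxy =>
    measureReal_mono (Iic_subset_Iic.2 hxy)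
  set s := {x | G.real (Iic x) ≤ u}
  apply le_antisymm
  · obtain ⟨v, huv, hv1⟩ := exists_between h1
    obtain ⟨y, hy⟩ := exists_measureReal_Iic_eq G (h0.trans_lt huv) (by simpa using hv1)
    have hbdd : BddAbove s := ⟨y, fun x hx => (hmono.reflect_lt
      (lt_of_le_of_lt hx (huv.trans_eq hy.symm))).le⟩
    rcases s.eq_empty_or_nonempty with hs | hs
    · simpa [hs] using h0
    · have hclosed : IsClosed s := isClosed_le (continuous_measureReal_Iic G) continuous_const
      exact (measureReal_mono fun x hx => le_csSup hbdd hx).trans (hclosed.csSup_mem hs hbdd)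
  · rcases h0.eq_or_lt with rfl | h0
    · exact measureReal_nonneg
    obtain ⟨y, hy⟩ := exists_measureReal_Iic_eq G h0 (by simpa using h1)
    calc u = G.real (Iic y) := hy.symm
      _ ≤ G.real s := measureReal_mono fun x hx => (hmono hx).trans hy.le

lemma map_measureReal_Iic :
    G.map (fun x => G.real (Iic x)) = volume.restrict (Icc 0 1) := by
  have hc := (continuous_measureReal_Iic G).measurable
  have := Measure.isProbabilityMeasure_map (μ := G) hc.aemeasurable
  refine Measure.ext_of_Iic _ _ fun u => ?_
  rw [Measure.map_apply hc measurableSet_Iic, Measure.restrict_apply measurableSet_Iic]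
  rcases lt_or_ge u 0 with h0 | h0
  · have h : ∀ x, ¬G.real (Iic x) ≤ u := fun x => not_le.2 (h0.trans_le measureReal_nonneg)
    have h' : Iic u ∩ Icc 0 1 = ∅ := by grind
    simp [preimage, h, h']
  rcases lt_or_ge u 1 with h1 | h1
  · have h : Iic u ∩ Icc 0 1 = Icc 0 u := by grind
    rw [h, Real.volume_Icc, sub_zero, ← ofReal_measureReal]
    exact congrArg ENNReal.ofReal (measureReal_setOf_measureReal_Iic_le G h0 h1)
  · have h : ∀ x, G.real (Iic x) ≤ u := fun x => measureReal_le_one.trans h1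
    have h' : Iic u ∩ Icc 0 1 = Icc 0 1 := by grind
    simp [preimage, h, h']

lemma integral_comp_measureReal_Iic {f : ℝ → ℝ} (hf : ContinuousOn f (Icc 0 1)) :
    ∫ x, f (G.real (Iic x)) ∂G = ∫ u in (0 : ℝ)..1, f u := by
  rw [intervalIntegral.integral_of_le zero_le_one, ← integral_Icc_eq_integral_Ioc,
    ← map_measureReal_Iic G, integral_map (continuous_measureReal_Iic G).aemeasurable]
  rw [map_measureReal_Iic G]
  exact hf.aestronglyMeasurable measurableSet_Icc

end Atomless

lemma integrable_comp_of_ae_mem_Icc {α : Type*} [MeasurableSpace α] {μ : Measure α}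
    [IsFiniteMeasure μ] {X : α → ℝ} {a b : ℝ} {f : ℝ → ℝ} (hf : Continuous f) (hX : Measurable X)
    (hab : ∀ᵐ x ∂μ, X x ∈ Icc a b) : Integrable (fun x => f (X x)) μ := by
  obtain ⟨C, hC⟩ := (isCompact_Icc (a := a) (b := b)).exists_bound_of_continuousOn hf.continuousOn
  exact .of_bound (hf.measurable.comp hX).aestronglyMeasurable C (hab.mono fun x hx => hC _ hx)

section RankMatching

lemma mul_sub_le_integral_of_monotone {P : ℝ → ℝ} (hP : Monotone P) (a b : ℝ) :
    P a * (b - a) ≤ ∫ x in a..b, P x := by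
  rcases le_total a b with h | h
  · calc P a * (b - a) = ∫ _ in a..b, P a := by simp [mul_comm]
      _ ≤ ∫ x in a..b, P x := intervalIntegral.integral_mono_on h intervalIntegrable_const
          hP.intervalIntegrable fun x hx => hP hx.1
  · have : ∫ x in b..a, P x ≤ ∫ _ in b..a, P a :=
      intervalIntegral.integral_mono_on h hP.intervalIntegrable intervalIntegrable_const
        fun x hx => hP hx.2
    rw [intervalIntegral.integral_const, smul_eq_mul] at this
    rw [intervalIntegral.integral_symm]
    linarith

variable {G : Measure ℝ} [IsProbabilityMeasure G] {P : ℝ → ℝ} {a b : ℝ}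

lemma integral_sub_mean (hi : Integrable (fun x => x) G) : ∫ x, (x - ∫ y, y ∂G) ∂G = 0 := by
  rw [integral_sub hi (integrable_const _)]
  simp

lemma integral_mul_integral_le_of_monotone (hG : ∀ᵐ x ∂G, x ∈ Icc a b) (hc : Continuous P)
    (hmono : Monotone P) : (∫ x, x ∂G) * ∫ x, P x ∂G ≤ ∫ x, x * P x ∂G := by
  have hi : ∀ {f : ℝ → ℝ}, Continuous f → Integrable f G := fun hf =>
    integrable_comp_of_ae_mem_Icc hf measurable_id hG
  set m := ∫ x, x ∂G
  have hcov : 0 ≤ ∫ x, (x - m) * (P x - P m) ∂G := integral_nonneg fun x => by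
    rcases le_total x m with hx | hx
    · exact mul_nonneg_of_nonpos_of_nonpos (sub_nonpos.2 hx) (sub_nonpos.2 (hmono hx))
    · exact mul_nonneg (sub_nonneg.2 hx) (sub_nonneg.2 (hmono hx))
  have hexpand : ∫ x, (x - m) * (P x - P m) ∂G = ∫ x, x * P x ∂G - m * ∫ x, P x ∂G := by
    calc ∫ x, (x - m) * (P x - P m) ∂G
      _ = ∫ x, ((x * P x - m * P x) - P m * (x - m)) ∂G :=
          integral_congr_ae (ae_of_all _ fun x => by ring)
      _ = ∫ x, x * P x ∂G - m * ∫ x, P x ∂G := by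
          rw [integral_sub (hi (by fun_prop)) (hi (by fun_prop)), integral_const_mul,
            integral_sub_mean (hi continuous_id), integral_sub (hi (by fun_prop))
            (hi (by fun_prop)), integral_const_mul, mul_zero, sub_zero]
  linarith

lemma integral_measureReal_Iic_mul_sub_le [NullSingletonClass G] (hG : ∀ᵐ x ∂G, x ∈ Icc a b)
    (hc : Continuous P) (hmono : Monotone P) {m : ℝ} (hmean : ∫ x, x ∂G = m) :
    ∫ x, G.real (Iic x) * P x ∂G - ∫ x, x * P x ∂G ≤ ∫ u in (0 : ℝ)..1, ∫ x in m..u, P x := by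
  have hi : ∀ {f : ℝ → ℝ}, Continuous f → Integrable f G := fun hf =>
    integrable_comp_of_ae_mem_Icc hf measurable_id hG
  have hcdf := continuous_measureReal_Iic G
  have hΦ : Continuous fun u => ∫ x in m..u, P x :=
    intervalIntegral.continuous_primitive (fun _ _ => hc.intervalIntegrable _ _) m
  have hcentred : ∫ x, P m * (x - m) ∂G = 0 := by
    rw [integral_const_mul, ← hmean, integral_sub_mean (hi continuous_id), mul_zero]
  calc ∫ x, G.real (Iic x) * P x ∂G - ∫ x, x * P x ∂G
    _ = ∫ x, (P x * (G.real (Iic x) - x) + P m * (x - m)) ∂G := by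
        rw [integral_add (hi (by fun_prop)) (hi (by fun_prop)), hcentred, add_zero,
          ← integral_sub (hi (by fun_prop)) (hi (by fun_prop))]
        exact integral_congr_ae (ae_of_all _ fun x => by ring)
    _ ≤ ∫ x, (∫ y in m..G.real (Iic x), P y) ∂G := by
        refine integral_mono (hi (by fun_prop)) (hi (hΦ.comp hcdf)) fun x => ?_
        rw [← intervalIntegral.integral_add_adjacent_intervals (b := x)
          (hc.intervalIntegrable _ _) (hc.intervalIntegrable _ _), add_comm]
        exact add_le_add (mul_sub_le_integral_of_monotone hmono m x)
          (mul_sub_le_integral_of_monotone hmono x _)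
    _ = ∫ u in (0 : ℝ)..1, ∫ x in m..u, P x := integral_comp_measureReal_Iic G hΦ.continuousOn

lemma integral_mul_le_of_convexOn [NullSingletonClass G] (hG : ∀ᵐ x ∂G, x ∈ Icc a b)
    (hmean : ∫ x, x ∂G = 1 / 2) (hc : Continuous P) (hmono : Monotone P)
    (h0 : ∀ x ∈ Icc (0 : ℝ) 1, 0 ≤ P x) (hconv : ConvexOn ℝ (Icc 0 1) P)
    (hint : ∫ x in (0 : ℝ)..1, P x ≤ ∫ x, P x ∂G) {q : ℝ → ℝ} (hq : ContinuousOn q (Icc 0 1))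
    (hPq : ∀ᵐ x ∂G, P x = q (G.real (Iic x))) :
    ∫ u in (0 : ℝ)..1, u * q u ≤ 1.36 * ∫ x, x * P x ∂G := by
  have hrank : ∫ u in (0 : ℝ)..1, u * q u = ∫ x, G.real (Iic x) * P x ∂G := by
    rw [← integral_comp_measureReal_Iic G (f := fun u => u * q u)
      (continuousOn_id.mul hq)]
    exact integral_congr_ae (hPq.mono fun x hx => by simp [hx])
  have hcheb := integral_mul_integral_le_of_monotone hG hc hmono
  have hloss := integral_measureReal_Iic_mul_sub_le hG hc hmono hmean
  have hantideriv := integral_antiderivative_le hc h0 hmono hconv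
  rw [hmean] at hcheb
  rw [hrank]
  linarith

end RankMatching

section Transcript

variable {F : Measure ℝ} {κ : Kernel ℝ ℝ}

lemma measurePreserving_fst_compProd [SFinite F] [IsMarkovKernel κ] :
    MeasurePreserving Prod.fst (F ⊗ₘ κ) F :=
  ⟨measurable_fst, Measure.fst_compProd F κ⟩

lemma integral_fst_compProd [SFinite F] [IsMarkovKernel κ] {f : ℝ → ℝ} (hf : Measurable f) :
    ∫ p, f p.1 ∂(F ⊗ₘ κ) = ∫ a, f a ∂F := by
  rw [← integral_map measurable_fst.aemeasurable hf.aestronglyMeasurable,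
    measurePreserving_fst_compProd.map_eq]

lemma integrable_fst_compProd [SFinite F] [IsMarkovKernel κ] {f : ℝ → ℝ} (hf : Integrable f F) :
    Integrable (fun p : ℝ × ℝ => f p.1) (F ⊗ₘ κ) :=
  measurePreserving_fst_compProd.integrable_comp_of_integrable hf

instance isFiniteMeasure_gradeDist [IsFiniteMeasure F] [IsMarkovKernel κ] :
    IsFiniteMeasure (gradeDist F κ) := by
  unfold gradeDist
  infer_instance

instance isProbabilityMeasure_gradeDist [IsProbabilityMeasure F] [IsMarkovKernel κ] :
    IsProbabilityMeasure (gradeDist F κ) :=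
  Measure.isProbabilityMeasure_map measurable_snd.aemeasurable

lemma integral_gradeDist {f : ℝ → ℝ} (hf : Measurable f) :
    ∫ x, f x ∂(gradeDist F κ) = ∫ p, f p.2 ∂(F ⊗ₘ κ) :=
  integral_map measurable_snd.aemeasurable hf.aestronglyMeasurable

lemma setIntegral_gradeDist {f : ℝ → ℝ} (hf : Measurable f) {B : Set ℝ} (hB : MeasurableSet B) :
    ∫ x in B, f x ∂(gradeDist F κ) = ∫ p in Prod.snd ⁻¹' B, f p.2 ∂(F ⊗ₘ κ) :=
  setIntegral_map hB hf.aestronglyMeasurable measurable_snd.aemeasurable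

lemma gradeDist_apply {B : Set ℝ} (hB : MeasurableSet B) :
    gradeDist F κ B = (F ⊗ₘ κ) (Prod.snd ⁻¹' B) :=
  Measure.map_apply measurable_snd hB

lemma gradeDist_real_apply {B : Set ℝ} (hB : MeasurableSet B) :
    (gradeDist F κ).real B = (F ⊗ₘ κ).real (Prod.snd ⁻¹' B) :=
  congrArg ENNReal.toReal (gradeDist_apply hB)

lemma gradeDist_real_univ [SFinite F] [IsMarkovKernel κ] :
    (gradeDist F κ).real univ = F.real univ := by
  rw [gradeDist_real_apply .univ, preimage_univ, measureReal_def, Measure.compProd_apply_univ,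
    measureReal_def]

lemma gradeDist_id [SFinite F] : gradeDist F Kernel.id = F := by
  rw [gradeDist, Measure.compProd_id, Measure.map_map measurable_snd (by fun_prop)]
  exact Measure.map_id

namespace IsTranscript

lemma of_setIntegral_eq [IsFiniteMeasure F] [IsMarkovKernel κ] (hF : Integrable (fun a => a) F)
    (hsnd : Integrable Prod.snd (F ⊗ₘ κ))
    (h : ∀ C, MeasurableSet C →
      ∫ p in Prod.snd ⁻¹' C, p.2 ∂(F ⊗ₘ κ) = ∫ p in Prod.snd ⁻¹' C, p.1 ∂(F ⊗ₘ κ)) :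
    IsTranscript F κ := by
  refine ⟨inferInstance, (ae_eq_condExp_of_forall_setIntegral_eq measurable_snd.comap_le
    (integrable_fst_compProd hF) (fun _ _ _ => hsnd.integrableOn) ?_
    (comap_measurable Prod.snd).aestronglyMeasurable).symm⟩
  rintro _ ⟨C, hC, rfl⟩ -
  exact h C hC

lemma integrable_snd (hκ : IsTranscript F κ) : Integrable Prod.snd (F ⊗ₘ κ) :=
  integrable_condExp.congr hκ.calibrated

variable [IsFiniteMeasure F]

lemma integral_mul_fst (hκ : IsTranscript F κ) (hF : Integrable (fun a => a) F) {ψ : ℝ → ℝ}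
    (hψ : Measurable ψ) (hψF : Integrable (fun p => ψ p.2 * p.1) (F ⊗ₘ κ)) :
    ∫ p, ψ p.2 * p.1 ∂(F ⊗ₘ κ) = ∫ x, ψ x * x ∂(gradeDist F κ) := by
  have := hκ.markov
  have hψm : StronglyMeasurable[MeasurableSpace.comap Prod.snd inferInstance]
      fun p : ℝ × ℝ => ψ p.2 := (hψ.comp (comap_measurable Prod.snd)).stronglyMeasurable
  rw [integral_gradeDist (f := fun x => ψ x * x) (by fun_prop),
    ← integral_condExp measurable_snd.comap_le]
  refine integral_congr_ae ((condExp_mul_of_stronglyMeasurable_left hψm hψF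
    (integrable_fst_compProd hF)).trans ?_)
  filter_upwards [hκ.calibrated] with p hp
  exact congrArg (ψ p.2 * ·) hp

lemma setIntegral_fst (hκ : IsTranscript F κ) (hF : Integrable (fun a => a) F) {B : Set ℝ}
    (hB : MeasurableSet B) :
    ∫ p in Prod.snd ⁻¹' B, p.1 ∂(F ⊗ₘ κ) = ∫ x in B, x ∂(gradeDist F κ) := by
  have := hκ.markov
  rw [setIntegral_gradeDist (f := fun x => x) measurable_id hB,
    ← setIntegral_condExp measurable_snd.comap_le (integrable_fst_compProd hF) ⟨B, hB, rfl⟩]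
  exact integral_congr_ae (ae_restrict_of_ae hκ.calibrated)

lemma integral_id_gradeDist (hκ : IsTranscript F κ) (hF : Integrable (fun a => a) F) :
    ∫ x, x ∂(gradeDist F κ) = ∫ a, a ∂F := by
  have := hκ.markov
  have h := hκ.setIntegral_fst hF .univ
  simp only [preimage_univ, Measure.restrict_univ] at h
  rw [← h, integral_fst_compProd (f := fun a => a) measurable_id]

lemma ae_gradeDist_mem_Icc (hκ : IsTranscript F κ) {a b : ℝ} (hF : ∀ᵐ x ∂F, x ∈ Icc a b) :
    ∀ᵐ x ∂(gradeDist F κ), x ∈ Icc a b := by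
  have := hκ.markov
  have hle : MeasurableSpace.comap (Prod.snd : ℝ × ℝ → ℝ) inferInstance
      ≤ Prod.instMeasurableSpace := measurable_snd.comap_le
  have hfst : Integrable (fun p : ℝ × ℝ => p.1) (F ⊗ₘ κ) :=
    integrable_fst_compProd (integrable_comp_of_ae_mem_Icc continuous_id measurable_id hF)
  have hmem := Measure.ae_compProd_of_ae_fst κ measurableSet_Icc hF
  have ha := condExp_mono (m := MeasurableSpace.comap Prod.snd inferInstance)
    (integrable_const a) hfst (hmem.mono fun p hp => hp.1)
  have hb := condExp_mono (m := MeasurableSpace.comap Prod.snd inferInstance)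
    hfst (integrable_const b) (hmem.mono fun p hp => hp.2)
  rw [condExp_const hle] at ha hb
  refine (ae_map_iff measurable_snd.aemeasurable measurableSet_Icc).2 ?_
  filter_upwards [ha, hb, hκ.calibrated] with p hpa hpb hp
  exact ⟨hp ▸ hpa, hp ▸ hpb⟩

lemma integral_gradeDist_le_of_convexOn (hκ : IsTranscript F κ) {a b : ℝ}
    (hF : ∀ᵐ x ∂F, x ∈ Icc a b) {R : ℝ → ℝ} (hR : ConvexOn ℝ univ R) (hc : Continuous R) :
    ∫ x, R x ∂(gradeDist F κ) ≤ ∫ x, R x ∂F := by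
  have := hκ.markov
  have hint : ∀ {f : ℝ → ℝ}, Continuous f → Integrable (fun p : ℝ × ℝ => f p.1) (F ⊗ₘ κ) :=
    fun hf => integrable_fst_compProd (integrable_comp_of_ae_mem_Icc hf measurable_id hF)
  have hRG : Integrable (fun p : ℝ × ℝ => R p.2) (F ⊗ₘ κ) :=
    integrable_comp_of_ae_mem_Icc hc measurable_snd
      (ae_of_ae_map measurable_snd.aemeasurable (hκ.ae_gradeDist_mem_Icc hF))
  have hjensen := hR.map_condExp_le_univ (μ := F ⊗ₘ κ) measurable_snd.comap_le
    hc.lowerSemicontinuous (hint continuous_id) (hint hc)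
  calc ∫ x, R x ∂(gradeDist F κ)
      = ∫ p, R p.2 ∂(F ⊗ₘ κ) := integral_gradeDist hc.measurable
    _ ≤ ∫ p, ((F ⊗ₘ κ)[fun p : ℝ × ℝ => R p.1 |
          MeasurableSpace.comap Prod.snd inferInstance]) p ∂(F ⊗ₘ κ) := by
        refine integral_mono_ae hRG integrable_condExp ?_
        filter_upwards [hjensen, hκ.calibrated] with p hp hcal
        exact (congrArg R hcal).symm.trans_le hp
    _ = ∫ p, R p.1 ∂(F ⊗ₘ κ) := integral_condExp measurable_snd.comap_le
    _ = ∫ x, R x ∂F := integral_fst_compProd hc.measurable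

end IsTranscript

lemma isTranscript_id [IsFiniteMeasure F] (hF : Integrable (fun a => a) F) :
    IsTranscript F Kernel.id := by
  have hdiag : ∀ᵐ p ∂(F ⊗ₘ Kernel.id), p.1 = p.2 := by
    rw [Measure.compProd_id]
    exact (ae_map_iff (by fun_prop) (measurableSet_eq_fun measurable_fst measurable_snd)).2
      (ae_of_all _ fun _ => rfl)
  exact .of_setIntegral_eq hF ((integrable_fst_compProd hF).congr hdiag) fun C hC =>
    setIntegral_congr_ae (measurable_snd hC) (hdiag.mono fun p hp _ => hp.symm)

end Transcript

section Regrading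

variable {F : Measure ℝ} [IsFiniteMeasure F] {κ : Kernel ℝ ℝ} [IsMarkovKernel κ]

lemma exists_isTranscript_of_calibrated (hF : Integrable (fun a => a) F) {T : ℝ × ℝ → ℝ}
    (hT : Measurable T) (hTi : Integrable T (F ⊗ₘ κ))
    (hcal : ∀ C, MeasurableSet C →
      ∫ p in T ⁻¹' C, T p ∂(F ⊗ₘ κ) = ∫ p in T ⁻¹' C, p.1 ∂(F ⊗ₘ κ)) :
    ∃ κ', IsTranscript F κ' ∧ gradeDist F κ' = (F ⊗ₘ κ).map T := by
  have hS : Measurable fun p : ℝ × ℝ => (p.1, T p) := by fun_prop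
  set ρ := (F ⊗ₘ κ).map fun p => (p.1, T p) with hρ
  have hfst : ρ.fst = F := by
    rw [hρ, Measure.fst, Measure.map_map measurable_fst hS]
    exact measurePreserving_fst_compProd.map_eq
  have hdis : F ⊗ₘ ρ.condKernel = ρ := by
    have h := ρ.disintegrate ρ.condKernel
    rwa [hfst] at h
  refine ⟨ρ.condKernel, .of_setIntegral_eq hF ?_ fun C hC => ?_, ?_⟩
  · rw [hdis, hρ]
    exact (integrable_map_measure measurable_snd.aestronglyMeasurable hS.aemeasurable).2 hTi
  · rw [hdis, hρ, setIntegral_map (measurable_snd hC) measurable_snd.aestronglyMeasurable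
      hS.aemeasurable, setIntegral_map (measurable_snd hC) measurable_fst.aestronglyMeasurable
      hS.aemeasurable]
    exact hcal C hC
  · rw [gradeDist, hdis, hρ, Measure.map_map measurable_snd hS]
    rfl

end Regrading

section BestResponse

variable {Q : ℝ → ℝ} {F : Measure ℝ} {κ : Kernel ℝ ℝ} {A : Set (ℝ × ℝ)} {B : Set ℝ} {c : ℝ}

/-- The transcript structure `κ` maximizes the average placement of a school with ability
distribution `F` when a student of grade `x` gets a job of quality `Q x`. -/
def IsBestResponse (Q : ℝ → ℝ) (F : Measure ℝ) (κ : Kernel ℝ ℝ) : Prop :=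
  IsTranscript F κ ∧ ∀ κ', IsTranscript F κ' →
    ∫ x, Q x ∂(gradeDist F κ') ≤ ∫ x, Q x ∂(gradeDist F κ)

open scoped Classical in
/-- The new grade of a student with (ability, old grade) `p` when the students in `A` are pooled at
grade `c`, the others with an old grade in `B` are graded truthfully, and the rest are unaffected.
This single deviation, with various `A` and `B`, yields all properties of best responses. -/
noncomputable def regrade (A : Set (ℝ × ℝ)) (c : ℝ) (B : Set ℝ) : ℝ × ℝ → ℝ :=
  A.piecewise (fun _ => c) ((Prod.snd ⁻¹' B).piecewise Prod.fst Prod.snd)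

open scoped Classical in
lemma measurable_regrade (hA : MeasurableSet A) (hB : MeasurableSet B) :
    Measurable (regrade A c B) :=
  .piecewise hA measurable_const (.piecewise (measurable_snd hB) measurable_fst measurable_snd)

open scoped Classical in
lemma integrable_regrade {J : Measure (ℝ × ℝ)} [IsFiniteMeasure J] (hfst : Integrable Prod.fst J)
    (hsnd : Integrable Prod.snd J) (hA : MeasurableSet A) (hB : MeasurableSet B) :
    Integrable (regrade A c B) J :=
  .piecewise hA integrableOn_const
    (Integrable.piecewise (measurable_snd hB) hfst.integrableOn hsnd.integrableOn).integrableOn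

open scoped Classical in
lemma integral_comp_regrade {J : Measure (ℝ × ℝ)} (hA : MeasurableSet A) (hB : MeasurableSet B)
    (hAB : A ⊆ Prod.snd ⁻¹' B) {f : ℝ → ℝ → ℝ}
    (hf : Integrable (fun p => f p.1 (regrade A c B p)) J) :
    ∫ p, f p.1 (regrade A c B p) ∂J = ∫ p in A, f p.1 c ∂J +
      ∫ p in Prod.snd ⁻¹' B \ A, f p.1 p.1 ∂J + ∫ p in Prod.snd ⁻¹' Bᶜ, f p.1 p.2 ∂J := by
  have hE : MeasurableSet (Prod.snd ⁻¹' B : Set (ℝ × ℝ)) := measurable_snd hB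
  rw [← integral_add_compl hE hf, ← integral_inter_add_sdiff hA hf.integrableOn,
    inter_eq_right.2 hAB, ← preimage_compl]
  refine congrArg₂ (· + ·) (congrArg₂ (· + ·) ?_ ?_) ?_
  · exact setIntegral_congr_fun hA fun p hp => by simp only [regrade, piecewise_eq_of_mem _ _ _ hp]
  · refine setIntegral_congr_fun (hE.diff hA) fun p hp => ?_
    simp only [regrade, piecewise_eq_of_notMem _ _ _ hp.2, piecewise_eq_of_mem _ _ _ hp.1]
  · refine setIntegral_congr_fun (measurable_snd hB.compl) fun p hp => ?_
    have hpA : p ∉ A := fun h => hp (hAB h)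
    have hpB : p ∉ Prod.snd ⁻¹' B := hp
    simp only [regrade, piecewise_eq_of_notMem _ _ _ hpA, piecewise_eq_of_notMem _ _ _ hpB]

variable [IsFiniteMeasure F]

lemma IsTranscript.setIntegral_regrade (hκ : IsTranscript F κ) (hF : Integrable (fun a => a) F)
    (hA : MeasurableSet A) (hB : MeasurableSet B) (hAB : A ⊆ Prod.snd ⁻¹' B)
    (hc : ∫ p in A, p.1 ∂(F ⊗ₘ κ) = c * (F ⊗ₘ κ).real A) {C : Set ℝ} (hC : MeasurableSet C) :
    ∫ p in regrade A c B ⁻¹' C, regrade A c B p ∂(F ⊗ₘ κ)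
      = ∫ p in regrade A c B ⁻¹' C, p.1 ∂(F ⊗ₘ κ) := by
  have := hκ.markov
  have hfst : Integrable (fun p => p.1) (F ⊗ₘ κ) := integrable_fst_compProd hF
  have hT : Integrable (regrade A c B) (F ⊗ₘ κ) := integrable_regrade hfst hκ.integrable_snd hA hB
  have hTm : MeasurableSet (regrade A c B ⁻¹' C) := measurable_regrade hA hB hC
  have hpooled : ∫ p in A, C.indicator (fun x => x - p.1) c ∂(F ⊗ₘ κ) = 0 := by
    by_cases hcC : c ∈ C
    · simp only [indicator_of_mem hcC]
      rw [integral_sub (integrable_const c) hfst.integrableOn, hc, setIntegral_const, smul_eq_mul,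
        mul_comm, sub_self]
    · simp only [indicator_of_notMem hcC, integral_zero]
  have hrevealed : ∫ p in Prod.snd ⁻¹' B \ A, C.indicator (fun x => x - p.1) p.1 ∂(F ⊗ₘ κ) = 0 := by
    simp only [sub_self, indicator, ite_self, integral_zero]
  have hunaffected : ∫ p in Prod.snd ⁻¹' Bᶜ, C.indicator (fun x => x - p.1) p.2 ∂(F ⊗ₘ κ) = 0 := by
    calc ∫ p in Prod.snd ⁻¹' Bᶜ, C.indicator (fun x => x - p.1) p.2 ∂(F ⊗ₘ κ)
        = ∫ p in Prod.snd ⁻¹' Bᶜ, (Prod.snd ⁻¹' C).indicator (fun p => p.2 - p.1) p ∂(F ⊗ₘ κ) := rfl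
      _ = ∫ p in Prod.snd ⁻¹' (Bᶜ ∩ C), (p.2 - p.1) ∂(F ⊗ₘ κ) :=
          setIntegral_indicator (measurable_snd hC)
      _ = 0 := by
          rw [integral_sub hκ.integrable_snd.integrableOn hfst.integrableOn,
            hκ.setIntegral_fst hF (hB.compl.inter hC),
            setIntegral_gradeDist (f := fun x => x) measurable_id (hB.compl.inter hC), sub_self]
  have hint : Integrable ((regrade A c B ⁻¹' C).indicator fun p => regrade A c B p - p.1)
      (F ⊗ₘ κ) := (hT.sub hfst).indicator hTm
  rw [← sub_eq_zero, ← integral_sub hT.integrableOn hfst.integrableOn, ← integral_indicator hTm]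
  refine (integral_comp_regrade (f := fun a x => C.indicator (fun x => x - a) x)
    hA hB hAB hint).trans ?_
  rw [hpooled, hrevealed, hunaffected, add_zero, add_zero]

namespace IsBestResponse

lemma setIntegral_regrade_le (h : IsBestResponse Q F κ) (hF : Integrable (fun a => a) F)
    (hQ : Measurable Q) (hQb : ∀ x, Q x ∈ Icc 0 1) (hA : MeasurableSet A) (hB : MeasurableSet B)
    (hAB : A ⊆ Prod.snd ⁻¹' B) (hc : ∫ p in A, p.1 ∂(F ⊗ₘ κ) = c * (F ⊗ₘ κ).real A) :
    Q c * (F ⊗ₘ κ).real A + ∫ p in Prod.snd ⁻¹' B \ A, Q p.1 ∂(F ⊗ₘ κ)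
      ≤ ∫ x in B, Q x ∂(gradeDist F κ) := by
  have := h.1.markov
  have hQi : ∀ {T : ℝ × ℝ → ℝ}, Measurable T → Integrable (fun p => Q (T p)) (F ⊗ₘ κ) := fun hT =>
    .of_mem_Icc 0 1 (hQ.comp hT).aemeasurable (ae_of_all _ fun _ => hQb _)
  have hT : Measurable (regrade A c B) := measurable_regrade hA hB
  obtain ⟨κ', hκ', hgrade⟩ := exists_isTranscript_of_calibrated hF hT
    (integrable_regrade (integrable_fst_compProd hF) h.1.integrable_snd hA hB)
    fun C hC => h.1.setIntegral_regrade hF hA hB hAB hc hC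
  have hle := h.2 κ' hκ'
  rw [hgrade, integral_map hT.aemeasurable hQ.aestronglyMeasurable, integral_gradeDist hQ,
    integral_comp_regrade (f := fun _ x => Q x) hA hB hAB (hQi hT), setIntegral_const,
    smul_eq_mul, mul_comm, ← integral_add_compl (measurable_snd hB) (hQi measurable_snd),
    ← preimage_compl] at hle
  rw [setIntegral_gradeDist hQ hB]
  exact le_of_add_le_add_right hle

lemma mul_le_setIntegral (h : IsBestResponse Q F κ) (hF : Integrable (fun a => a) F)
    (hQ : Measurable Q) (hQb : ∀ x, Q x ∈ Icc 0 1) (hB : MeasurableSet B)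
    (hc : ∫ x in B, x ∂(gradeDist F κ) = c * (gradeDist F κ).real B) :
    Q c * (gradeDist F κ).real B ≤ ∫ x in B, Q x ∂(gradeDist F κ) := by
  have hle := h.setIntegral_regrade_le hF hQ hQb (measurable_snd hB) hB Subset.rfl
    (by rwa [h.1.setIntegral_fst hF hB, ← gradeDist_real_apply hB])
  rwa [sdiff_self, setIntegral_empty, add_zero, ← gradeDist_real_apply hB] at hle

end IsBestResponse

end BestResponse

lemma abs_setIntegral_sub_le {α : Type*} [MeasurableSpace α] {μ : Measure α} {f : α → ℝ}
    {s : Set α} (hμs : μ s < ∞) (hf : IntegrableOn f s μ) {a C : ℝ} (h : ∀ x ∈ s, |f x - a| ≤ C) :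
    |∫ x in s, f x ∂μ - a * μ.real s| ≤ C * μ.real s := by
  have e : ∫ x in s, (f x - a) ∂μ = ∫ x in s, f x ∂μ - a * μ.real s := by
    rw [integral_sub hf (integrableOn_const hμs.ne), setIntegral_const, smul_eq_mul, mul_comm]
  rw [← e, ← Real.norm_eq_abs]
  exact norm_setIntegral_le_of_norm_le_const (f := fun x => f x - a) hμs fun x hx => h x hx

lemma exists_measureReal_eq_of_mem_support {G : Measure ℝ} [IsFiniteMeasure G]
    [NullSingletonClass G] {y z ρ : ℝ} (hy : y ∈ G.support) (hz : z ∈ G.support) (hρ : 0 < ρ) :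
    ∃ Y ⊆ Metric.ball y ρ, ∃ Z ⊆ Metric.ball z ρ, MeasurableSet Y ∧ MeasurableSet Z ∧
      0 < G.real Y ∧ G.real Z = G.real Y := by
  have : NullSingletonClass (G.map id) := by rwa [Measure.map_id]
  have hpos : ∀ {w}, w ∈ G.support → 0 < G.real (Metric.ball w ρ) := fun {w} hw =>
    ENNReal.toReal_pos (((Measure.mem_support_iff_forall w).1 hw _ (Metric.ball_mem_nhds w hρ)).ne')
      (measure_ne_top _ _)
  have hm := lt_min (hpos hy) (hpos hz)
  obtain ⟨Y, hY, hYm, hGY⟩ := exists_subset_measureReal_eq measurable_id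
    (Metric.isOpen_ball (x := y) (ε := ρ)).measurableSet hm.le (min_le_left _ _)
  obtain ⟨Z, hZ, hZm, hGZ⟩ := exists_subset_measureReal_eq measurable_id
    (Metric.isOpen_ball (x := z) (ε := ρ)).measurableSet hm.le (min_le_right _ _)
  exact ⟨Y, hY, Z, hZ, hYm, hZm, hm.trans_eq hGY.symm, hGZ.trans hGY.symm⟩

lemma two_mul_le_add_of_mem_support {G : Measure ℝ} [IsFiniteMeasure G] [NullSingletonClass G]
    {Q : ℝ → ℝ} (hQ : Continuous Q)
    (hG : ∀ B c, MeasurableSet B → ∫ x in B, x ∂G = c * G.real B →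
      Q c * G.real B ≤ ∫ x in B, Q x ∂G)
    {y z : ℝ} (hyz : y ≠ z) (hy : y ∈ G.support) (hz : z ∈ G.support) :
    2 * Q ((y + z) / 2) ≤ Q y + Q z := by
  refine le_of_forall_pos_le_add fun η hη => ?_
  have hnear : ∀ w, ∀ᶠ ρ in 𝓝[>] (0 : ℝ), ∀ x, |x - w| ≤ ρ → |Q x - Q w| ≤ η / 4 := fun w => by
    obtain ⟨ρ, hρ, h⟩ := Metric.continuous_iff.1 hQ w (η / 4) (by positivity)
    filter_upwards [Ioo_mem_nhdsGT hρ] with r hr x hx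
    exact (h x (hx.trans_lt hr.2)).le
  have hdist : 0 < |y - z| / 2 := half_pos (abs_pos.2 (sub_ne_zero.2 hyz))
  obtain ⟨ρ, ⟨hQy, hQz, hQm⟩, hρ, hρyz⟩ :=
    (((hnear y).and ((hnear z).and (hnear ((y + z) / 2)))).and (Ioo_mem_nhdsGT hdist)).exists
  obtain ⟨Y, hY, Z, hZ, hYm, hZm, hGY, hGZ⟩ := exists_measureReal_eq_of_mem_support hy hz hρ
  have hYZ : Disjoint Y Z := (Metric.ball_disjoint_ball (by rw [Real.dist_eq]; linarith)).mono hY hZ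
  have hi : ∀ {f : ℝ → ℝ} {w}, Continuous f → IntegrableOn f (Metric.ball w ρ) G := fun hf =>
    (hf.continuousOn.integrableOn_compact (isCompact_closedBall _ _)).mono_set
      Metric.ball_subset_closedBall
  have hest : ∀ {f : ℝ → ℝ} {S w C}, Continuous f → S ⊆ Metric.ball w ρ →
      (∀ x, |x - w| ≤ ρ → |f x - f w| ≤ C) → |∫ x in S, f x ∂G - f w * G.real S| ≤ C * G.real S :=
    fun hf hS h => abs_setIntegral_sub_le (measure_lt_top _ _) ((hi hf).mono_set hS)
      fun x hx => h x (hS hx).le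
  have hsplit : ∀ {f : ℝ → ℝ}, Continuous f →
      ∫ x in Y ∪ Z, f x ∂G = ∫ x in Y, f x ∂G + ∫ x in Z, f x ∂G := fun hf =>
    setIntegral_union hYZ hZm ((hi hf).mono_set hY) ((hi hf).mono_set hZ)
  have hmass : G.real (Y ∪ Z) = 2 * G.real Y := by rw [measureReal_union hYZ hZm, hGZ, two_mul]
  set c := (∫ x in Y ∪ Z, x ∂G) / G.real (Y ∪ Z)
  have hcm : ∫ x in Y ∪ Z, x ∂G = c * G.real (Y ∪ Z) :=
    (div_mul_cancel₀ _ (hmass ▸ by positivity)).symm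
  have hjensen := hG _ c (hYm.union hZm) hcm
  rw [hsplit continuous_id', hmass] at hcm
  rw [hsplit hQ, hmass] at hjensen
  have hxY := abs_le.1 (hest continuous_id' hY fun _ => id)
  have hxZ := abs_le.1 (hest continuous_id' hZ fun _ => id)
  have hIY := abs_le.1 (hest hQ hY hQy)
  have hIZ := abs_le.1 (hest hQ hZ hQz)
  rw [hGZ] at hxZ hIZ
  have hQc := abs_le.1 (hQm c (abs_le.2 ⟨by nlinarith, by nlinarith⟩))
  nlinarith

section NoAtoms

variable {α : Type*} [MeasurableSpace α] {μ : Measure α} [IsFiniteMeasure μ] {X : α → ℝ}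

lemma setIntegral_eq_setAverage_mul (A : Set α) :
    ∫ a in A, X a ∂μ = (⨍ a in A, X a ∂μ) * μ.real A := by
  rw [← measure_smul_setAverage _ (measure_ne_top _ _), smul_eq_mul, mul_comm]

lemma measureReal_inter_lt_setAverage_pos (hX : Measurable X) [NullSingletonClass (μ.map X)]
    {A : Set α} (hA : μ A ≠ 0) (hXA : IntegrableOn X A μ) :
    0 < μ.real (A ∩ {a | X a < ⨍ x in A, X x ∂μ}) := by
  set m := ⨍ x in A, X x ∂μ
  have hm : μ (X ⁻¹' {m}) = 0 := by
    rw [← Measure.map_apply hX (measurableSet_singleton m), measure_singleton]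
  refine ENNReal.toReal_pos (fun h0 => ?_) (measure_ne_top _ _)
  refine (measure_le_setAverage_pos hA (measure_ne_top μ A) hXA).ne' ?_
  exact measure_mono_null (fun a ha => (lt_or_eq_of_le ha.2).imp (⟨ha.1, ·⟩) id)
    (measure_union_null h0 hm)

lemma exists_setAverage_lt_setAverage_sdiff (hX : Measurable X) [NullSingletonClass (μ.map X)]
    {A : Set α} (hA : MeasurableSet A) (hXA : IntegrableOn X A μ) {v : ℝ} (hv : 0 < v)
    (hvA : v < μ.real A) :
    ∃ L ⊆ A, MeasurableSet L ∧ μ.real L ≤ v ∧ ⨍ a in A, X a ∂μ < ⨍ a in A \ L, X a ∂μ := by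
  set m := ⨍ a in A, X a ∂μ with hm
  have hlow := measureReal_inter_lt_setAverage_pos hX
    ((measureReal_ne_zero_iff (measure_ne_top _ _)).1 (hv.trans hvA).ne') hXA
  obtain ⟨L, hL, hLm, hLv⟩ := exists_subset_measureReal_eq hX
    (hA.inter (measurableSet_lt hX measurable_const)) (lt_min hlow hv).le (min_le_left _ _)
  have hLA : L ⊆ A := fun a ha => (hL ha).1
  have hL0 : 0 < μ.real L := (lt_min hlow hv).trans_eq hLv.symm
  have hLle : μ.real L ≤ v := hLv.trans_le (min_le_right _ _)
  refine ⟨L, hLA, hLm, hLle, ?_⟩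
  obtain ⟨a, haL, ha⟩ := exists_setAverage_le ((measureReal_ne_zero_iff (measure_ne_top _ _)).1
    hL0.ne') (measure_ne_top _ _) (hXA.mono_set hLA)
  have hLlt : ⨍ a in L, X a ∂μ < m := ha.trans_lt (hL haL).2
  have hsplit := integral_inter_add_sdiff hLm hXA
  rw [inter_eq_right.2 hLA, setIntegral_eq_setAverage_mul, setIntegral_eq_setAverage_mul,
    setIntegral_eq_setAverage_mul A, ← hm, measureReal_sdiff hLA hLm] at hsplit
  nlinarith

variable {Q : ℝ → ℝ} {F : Measure ℝ} [IsFiniteMeasure F] {κ : Kernel ℝ ℝ}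

lemma IsTranscript.setAverage_fst_singleton (hκ : IsTranscript F κ)
    (hF : Integrable (fun a => a) F) {x : ℝ} (hx : gradeDist F κ {x} ≠ 0) :
    ⨍ p in Prod.snd ⁻¹' {x}, p.1 ∂(F ⊗ₘ κ) = x := by
  have := hκ.markov
  rw [gradeDist_apply (measurableSet_singleton x)] at hx
  rw [setAverage_eq, hκ.setIntegral_fst hF (measurableSet_singleton x), integral_singleton,
    gradeDist_real_apply (measurableSet_singleton x), smul_smul,
    inv_mul_cancel₀ ((measureReal_ne_zero_iff (measure_ne_top _ _)).2 hx), one_smul]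

-- Pooling the students of an atom except for a few of the worst lifts them over the jump.
lemma IsBestResponse.gradeDist_singleton_eq_zero [NullSingletonClass F]
    (h : IsBestResponse Q F κ) (hF : Integrable (fun a => a) F) (hQ : Measurable Q)
    (hQb : ∀ x, Q x ∈ Icc 0 1) {x m : ℝ} (hxm : Q x < m) (hm : ∀ y > x, m ≤ Q y) :
    gradeDist F κ {x} = 0 := by
  by_contra hG
  have := h.1.markov
  have hmean := h.1.setAverage_fst_singleton hF hG
  rw [gradeDist_apply (measurableSet_singleton x)] at hG
  set J := F ⊗ₘ κ
  set E : Set (ℝ × ℝ) := Prod.snd ⁻¹' {x}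
  have hE : MeasurableSet E := measurable_snd (measurableSet_singleton x)
  have hJ : NullSingletonClass (J.map Prod.fst) := by
    rwa [measurePreserving_fst_compProd.map_eq]
  have hE0 : 0 < J.real E := ENNReal.toReal_pos hG (measure_ne_top _ _)
  have hm1 : m ≤ 1 := (hm (x + 1) (by linarith)).trans (hQb _).2
  have hv : 0 < J.real E * ((m - Q x) / 2) := mul_pos hE0 (by linarith)
  have hvE : J.real E * ((m - Q x) / 2) < J.real E := by nlinarith [(hQb x).1]
  obtain ⟨L, hLE, hLm, hLv, hup⟩ := exists_setAverage_lt_setAverage_sdiff measurable_fst hE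
    (integrable_fst_compProd hF).integrableOn hv hvE
  rw [hmean] at hup
  have hdev := h.setIntegral_regrade_le hF hQ hQb (hE.diff hLm) (measurableSet_singleton x)
    sdiff_subset (setIntegral_eq_setAverage_mul _)
  rw [integral_singleton, gradeDist_real_apply (measurableSet_singleton x), smul_eq_mul] at hdev
  have hnonneg : 0 ≤ ∫ p in E \ (E \ L), Q p.1 ∂J := integral_nonneg fun p => (hQb _).1
  have hgain : m * J.real (E \ L) ≤ Q (⨍ p in E \ L, p.1 ∂J) * J.real (E \ L) :=
    mul_le_mul_of_nonneg_right (hm _ hup) measureReal_nonneg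
  rw [measureReal_sdiff hLE hLm] at hgain hdev
  nlinarith [measureReal_nonneg (μ := J) (s := L)]

end NoAtoms

section PoolingAbove

variable {F : Measure ℝ} [IsFiniteMeasure F] {Q : ℝ → ℝ} {κ : Kernel ℝ ℝ} {a b d t : ℝ}

lemma exists_setIntegral_Ioi_eq_mul [NullSingletonClass F] (ha : ∀ᵐ x ∂F, a ≤ x)
    (hab : a ≤ b) (hF : Integrable (fun x => x) F) (hmean : ∫ x, x ∂F ≤ b * F.real univ)
    (hb : F (Ioi b) ≠ 0) :
    ∃ t < b, ∫ x in Ioi t, x ∂F = b * F.real (Ioi t) := by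
  have hint : Integrable (fun x => x - b) F := hF.sub (integrable_const b)
  set g : ℝ → ℝ := fun t => ∫ x in Ioi t, (x - b) ∂F
  have hg : ∀ t, g t = g a - ∫ x in a..t, (x - b) ∂F := fun t => by
    rw [← intervalIntegral.integral_Ioi_sub_Ioi' hint.integrableOn hint.integrableOn,
      sub_sub_cancel]
  have hcont : Continuous g := by
    rw [funext hg]
    exact continuous_const.sub
      (intervalIntegral.continuous_primitive (fun _ _ => hint.intervalIntegrable) a)
  have hga : g a ≤ 0 := by
    have hae : Ioi a =ᵐ[F] univ := Ioi_ae_eq_Ici.trans (eventuallyEq_univ.2 ha)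
    simp only [g]
    rw [setIntegral_congr_set hae, Measure.restrict_univ, integral_sub hF (integrable_const b),
      integral_const, smul_eq_mul]
    linarith
  have hgb : 0 < g b := by
    refine (setIntegral_pos_iff_support_of_nonneg_ae ?_ hint.integrableOn).2 ?_
    · exact ae_restrict_of_forall_mem measurableSet_Ioi fun x hx => sub_nonneg.2 hx.le
    · refine (pos_iff_ne_zero.2 hb).trans_le (measure_mono fun x hx => ⟨?_, hx⟩)
      exact sub_ne_zero.2 hx.ne'
  obtain ⟨t, ht, hgt⟩ := intermediate_value_Icc hab hcont.continuousOn ⟨hga, hgb.le⟩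
  refine ⟨t, ht.2.lt_of_ne fun h => hgb.ne' (h ▸ hgt), ?_⟩
  have hsub : g t = ∫ x in Ioi t, x ∂F - b * F.real (Ioi t) := by
    simp only [g]
    rw [integral_sub hF.integrableOn (integrable_const b), setIntegral_const, smul_eq_mul, mul_comm]
  linarith

lemma integral_extendLine {s : ℝ} (hF : Integrable (fun x => x) F)
    (hP : Integrable (extendLine Q t s) F) (ht : ∫ x in Ioi t, x ∂F = b * F.real (Ioi t)) :
    ∫ x, extendLine Q t s x ∂F
      = (Q t + s * (b - t)) * F.real (Ioi t) + ∫ x in Iic t, Q x ∂F := by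
  have habove : ∫ x in Ioi t, extendLine Q t s x ∂F = (Q t + s * (b - t)) * F.real (Ioi t) := by
    calc ∫ x in Ioi t, extendLine Q t s x ∂F
        = ∫ x in Ioi t, ((Q t - s * t) + s * x) ∂F :=
          setIntegral_congr_fun measurableSet_Ioi fun x hx => by
            simp only [extendLine_of_ge (le_of_lt hx)]
            ring
      _ = (Q t + s * (b - t)) * F.real (Ioi t) := by
          rw [integral_add (integrable_const _) (hF.integrableOn.const_mul s), setIntegral_const,
            integral_const_mul, ht, smul_eq_mul]
          ring
  rw [← integral_add_compl measurableSet_Iic hP, compl_Iic, habove, add_comm]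
  congr 1
  exact setIntegral_congr_fun measurableSet_Iic fun x hx => extendLine_of_le hx

namespace IsBestResponse

lemma integral_extendLine_le (h : IsBestResponse Q F κ) (hF : Integrable (fun x => x) F)
    (hQ : Measurable Q) (hQb : ∀ x, Q x ∈ Icc 0 1)
    (hP : Integrable (extendLine Q t (slope Q t b)) F) (htb : t < b)
    (ht : ∫ x in Ioi t, x ∂F = b * F.real (Ioi t)) :
    ∫ x, extendLine Q t (slope Q t b) x ∂F ≤ ∫ x, Q x ∂(gradeDist F κ) := by
  have := h.1.markov
  have hfst : MeasurePreserving Prod.fst (F ⊗ₘ κ) F := measurePreserving_fst_compProd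
  have hset : ∀ {f : ℝ → ℝ} {A : Set ℝ}, Measurable f → MeasurableSet A →
      ∫ p in Prod.fst ⁻¹' A, f p.1 ∂(F ⊗ₘ κ) = ∫ x in A, f x ∂F := fun {f A} hf hA => by
    rw [← setIntegral_map hA hf.aestronglyMeasurable measurable_fst.aemeasurable, hfst.map_eq]
  have hmass : (F ⊗ₘ κ).real (Prod.fst ⁻¹' Ioi t) = F.real (Ioi t) :=
    congrArg ENNReal.toReal (hfst.measure_preimage measurableSet_Ioi.nullMeasurableSet)
  have hdev := h.setIntegral_regrade_le (A := Prod.fst ⁻¹' Ioi t) (c := b) hF hQ hQb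
    (measurable_fst measurableSet_Ioi) .univ (subset_univ _)
    (by rw [hset measurable_id' measurableSet_Ioi, hmass, ht])
  have hcompl : Prod.snd ⁻¹' univ \ Prod.fst ⁻¹' Ioi t = (Prod.fst ⁻¹' Iic t : Set (ℝ × ℝ)) := by
    rw [preimage_univ, ← compl_eq_univ_sdiff, ← preimage_compl, compl_Ioi]
  rwa [hcompl, hset hQ measurableSet_Iic, hmass, Measure.restrict_univ,
    ← extendLine_slope_right (Q := Q) htb, extendLine_of_ge htb.le,
    ← integral_extendLine hF hP ht] at hdev

variable (h : IsBestResponse Q F κ) (hF : ∀ᵐ x ∂F, x ∈ Icc a d) (hQ : Continuous Q)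
  (hQb : ∀ x, Q x ∈ Icc 0 1) (hconv : ConvexOn ℝ (Iic b) Q)
  (hG : ∀ᵐ x ∂(gradeDist F κ), x ≤ b) (htb : t < b)
  (ht : ∫ x in Ioi t, x ∂F = b * F.real (Ioi t))

include h hF hQ hQb hconv hG htb ht

lemma ae_eq_extendLine : ∀ᵐ x ∂(gradeDist F κ), Q x = extendLine Q t (slope Q t b) x := by
  have := h.1.markov
  set P := extendLine Q t (slope Q t b)
  have hPc : Continuous P := continuous_extendLine hQ t _
  have hFi : ∀ {f : ℝ → ℝ}, Continuous f → Integrable f F := fun hf =>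
    integrable_comp_of_ae_mem_Icc hf measurable_id hF
  have hGi : ∀ {f : ℝ → ℝ}, Continuous f → Integrable f (gradeDist F κ) := fun hf =>
    integrable_comp_of_ae_mem_Icc hf measurable_id (h.1.ae_gradeDist_mem_Icc hF)
  have hnonneg : 0 ≤ᵐ[gradeDist F κ] fun x => P x - Q x := hG.mono fun x hx =>
    sub_nonneg.2 (le_extendLine_slope hconv htb hx)
  have hle : ∫ x, P x ∂(gradeDist F κ) ≤ ∫ x, Q x ∂(gradeDist F κ) :=
    (h.1.integral_gradeDist_le_of_convexOn hF (convexOn_extendLine_slope hconv htb le_rfl)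
      hPc).trans (h.integral_extendLine_le (hFi continuous_id) hQ.measurable hQb (hFi hPc) htb ht)
  have hzero : ∫ x, P x - Q x ∂(gradeDist F κ) = 0 := by
    refine le_antisymm ?_ (integral_nonneg_of_ae hnonneg)
    rw [integral_sub (hGi hPc) (hGi hQ)]
    exact sub_nonpos.2 hle
  exact ((integral_eq_zero_iff_of_nonneg_ae hnonneg ((hGi hPc).sub (hGi hQ))).1 hzero).mono
    fun x hx => (sub_eq_zero.1 hx).symm

-- If `Q` were strictly below the chord on `(t, b)`, all grades would be at most `t`, and Jensen's
-- inequality for the extension of `Q` past `t` with a smaller slope would be violated.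
lemma eqOn_extendLine [NullSingletonClass (gradeDist F κ)] (hFt : F (Ioi t) ≠ 0) :
    EqOn Q (extendLine Q t (slope Q t b)) (Icc t b) := by
  have hae := h.ae_eq_extendLine hF hQ hQb hconv hG htb ht
  by_contra hne
  obtain ⟨w, hw, hQw⟩ := not_forall₂.1 hne
  have hwt : t < w := hw.1.lt_of_ne fun e => hQw (e ▸ (extendLine_of_le le_rfl).symm)
  have hle_t : ∀ᵐ x ∂(gradeDist F κ), x ≤ t := by
    filter_upwards [hae, hG, compl_mem_ae_iff.2 (measure_singleton b)] with x hx hxb hxne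
    exact not_lt.1 fun htx => hQw
      (extendLine_slope_eq_of_eq hconv htx (lt_of_le_of_ne hxb hxne) hx.symm hw.2).symm
  have hslope : slope Q t w < slope Q t b := by
    have hlt := (le_extendLine_slope hconv htb hw.2).lt_of_ne hQw
    rw [extendLine_of_ge hw.1] at hlt
    rw [slope_def_field, div_lt_iff₀ (sub_pos.2 hwt)]
    linarith
  have hFi : ∀ {f : ℝ → ℝ}, Continuous f → Integrable f F := fun hf =>
    integrable_comp_of_ae_mem_Icc hf measurable_id hF
  have hFt' : 0 < F.real (Ioi t) := ENNReal.toReal_pos hFt (measure_ne_top _ _)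
  have hjensen := h.1.integral_gradeDist_le_of_convexOn hF
    (convexOn_extendLine_slope hconv hwt hw.2) (continuous_extendLine hQ t _)
  have hdev := h.integral_extendLine_le (hFi continuous_id) hQ.measurable hQb
    (hFi (continuous_extendLine hQ t _)) htb ht
  rw [integral_congr_ae (hle_t.mono fun x hx => extendLine_of_le hx),
    integral_extendLine (hFi continuous_id) (hFi (continuous_extendLine hQ t _)) ht] at hjensen
  rw [integral_extendLine (hFi continuous_id) (hFi (continuous_extendLine hQ t _)) ht] at hdev
  have := mul_lt_mul_of_pos_right (mul_lt_mul_of_pos_right hslope (sub_pos.2 htb)) hFt'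
  linarith

omit htb ht in
lemma exists_convexOn_extendLine [NullSingletonClass F] [NullSingletonClass (gradeDist F κ)]
    (hab : a ≤ b) (hFb : F (Ioi b) ≠ 0) :
    ∃ s, (∀ᶠ x in 𝓝[<] b, Q x = Q b + s * (x - b)) ∧ ConvexOn ℝ univ (extendLine Q b s) ∧
      ∫ x, extendLine Q b s x ∂F ≤ ∫ x, Q x ∂(gradeDist F κ) := by
  have := h.1.markov
  have hFi : ∀ {f : ℝ → ℝ}, Continuous f → Integrable f F := fun hf =>
    integrable_comp_of_ae_mem_Icc hf measurable_id hF
  have hmean : ∫ x, x ∂F ≤ b * F.real univ := by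
    rw [← h.1.integral_id_gradeDist (hFi continuous_id), ← gradeDist_real_univ (κ := κ), mul_comm,
      ← smul_eq_mul, ← integral_const]
    exact integral_mono_ae (integrable_comp_of_ae_mem_Icc continuous_id measurable_id
      (h.1.ae_gradeDist_mem_Icc hF)) (integrable_const b) hG
  obtain ⟨t, htb, ht⟩ := exists_setIntegral_Ioi_eq_mul (hF.mono fun x hx => hx.1) hab
    (hFi continuous_id) hmean hFb
  have hline : EqOn Q (extendLine Q t (slope Q t b)) (Icc t b) :=
    h.eqOn_extendLine hF hQ hQb hconv hG htb ht fun h0 =>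
      hFb (measure_mono_null (Ioi_subset_Ioi htb.le) h0)
  have hQb' : ∀ x ∈ Icc t b, Q x = Q b + slope Q t b * (x - b) := fun x hx => by
    rw [hline hx, hline (right_mem_Icc.2 htb.le), extendLine_of_ge hx.1, extendLine_of_ge htb.le]
    ring
  refine ⟨slope Q t b, ?_, ?_⟩
  · filter_upwards [Ioo_mem_nhdsLT htb] with x hx using hQb' x ⟨hx.1.le, hx.2.le⟩
  · rw [extendLine_eq_of_affineOn htb.le hQb']
    exact ⟨convexOn_extendLine_slope hconv htb le_rfl, h.integral_extendLine_le
      (hFi continuous_id) hQ.measurable hQb (hFi (continuous_extendLine hQ t _)) htb ht⟩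

end IsBestResponse

end PoolingAbove

section Jobs

namespace Market

variable {ι : Type*} [Fintype ι] (M : Market ι)

instance isProbabilityMeasure_jobs : IsProbabilityMeasure M.jobs :=
  ⟨by rw [jobs, withDensity_apply _ .univ, Measure.restrict_univ, M.lintegral_jobDensity]⟩

instance nullSingletonClass_jobs : NullSingletonClass M.jobs :=
  ⟨fun x => withDensity_absolutelyContinuous _ _ (measure_singleton x)⟩

lemma strictMonoOn_measureReal_jobs_Iic :
    StrictMonoOn (fun x => M.jobs.real (Iic x)) (Icc 0 1) := by
  intro x hx y hy hxy
  have hpos : M.jobs (Ioc x y) ≠ 0 := by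
    rw [jobs, Ne, withDensity_apply_eq_zero' M.measurable_jobDensity.aemeasurable]
    have hIcc : Ioc x y ⊆ Icc 0 1 := fun a ha => ⟨hx.1.trans ha.1.le, ha.2.trans hy.2⟩
    have hsub : Ioc x y ⊆ {a | M.jobDensity a ≠ 0} ∩ Ioc x y := fun a ha =>
      ⟨(M.jobDensity_pos a (hIcc ha)).ne', ha⟩
    intro h0
    have h1 := measure_mono_null hsub h0
    rw [Measure.restrict_apply measurableSet_Ioc, inter_eq_left.2 hIcc, Real.volume_Ioc,
      ENNReal.ofReal_eq_zero] at h1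
    linarith
  have hsub : M.jobs.real (Ioc x y) = M.jobs.real (Iic y) - M.jobs.real (Iic x) := by
    rw [← Iic_sdiff_Iic, measureReal_sdiff (Iic_subset_Iic.2 hxy.le) measurableSet_Iic]
  exact sub_pos.1 (hsub ▸ ENNReal.toReal_pos hpos (measure_ne_top _ _))

lemma jobQuantile_measureReal_jobs_Iic {x : ℝ} (hx : x ∈ Icc (0 : ℝ) 1) :
    M.jobQuantile (M.jobs.real (Iic x)) = x := by
  have hset : {q ∈ Icc (0 : ℝ) 1 | M.jobs.real (Iic x) ≤ M.jobs.real (Iic q)} = Icc x 1 := by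
    ext q
    refine ⟨fun hq => ⟨(M.strictMonoOn_measureReal_jobs_Iic.le_iff_le hx hq.1).1 hq.2, hq.1.2⟩,
      fun hq => ?_⟩
    exact ⟨⟨hx.1.trans hq.1, hq.2⟩, measureReal_mono (Iic_subset_Iic.2 hq.1)⟩
  rw [jobQuantile, hset, csInf_Icc hx.2]

lemma measureReal_jobs_Iic_zero : M.jobs.real (Iic 0) = 0 := by
  have h0 : M.jobs (Iic 0) = 0 := by
    refine withDensity_absolutelyContinuous _ _ ?_
    rw [Measure.restrict_apply measurableSet_Iic]
    exact measure_mono_null (fun a ha => le_antisymm ha.1 ha.2.1) (measure_singleton 0)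
  rw [measureReal_def, h0, ENNReal.toReal_zero]

lemma measureReal_jobs_Iic_one : M.jobs.real (Iic 1) = 1 := by
  have h0 : M.jobs (Iic 1)ᶜ = 0 := by
    refine withDensity_absolutelyContinuous _ _ ?_
    rw [Measure.restrict_apply measurableSet_Iic.compl]
    exact measure_mono_null (t := ∅) (fun a ha => ha.1 ha.2.2) measure_empty
  rw [measureReal_def, (prob_compl_eq_zero_iff measurableSet_Iic).1 h0, ENNReal.toReal_one]

lemma exists_measureReal_jobs_Iic_eq {u : ℝ} (hu : u ∈ Icc (0 : ℝ) 1) :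
    ∃ x ∈ Icc (0 : ℝ) 1, M.jobs.real (Iic x) = u :=
  intermediate_value_Icc zero_le_one (continuous_measureReal_Iic M.jobs).continuousOn
    (by simpa only [measureReal_jobs_Iic_zero, measureReal_jobs_Iic_one] using hu)

lemma jobQuantile_zero : M.jobQuantile 0 = 0 := by
  have h := M.jobQuantile_measureReal_jobs_Iic (left_mem_Icc.2 zero_le_one)
  rwa [measureReal_jobs_Iic_zero] at h

lemma jobQuantile_mem_Icc {u : ℝ} (hu : u ∈ Icc (0 : ℝ) 1) :
    M.jobQuantile u ∈ Icc (0 : ℝ) 1 := by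
  obtain ⟨x, hx, rfl⟩ := M.exists_measureReal_jobs_Iic_eq hu
  rwa [M.jobQuantile_measureReal_jobs_Iic hx]

lemma strictMonoOn_jobQuantile : StrictMonoOn M.jobQuantile (Icc 0 1) := by
  intro u hu v hv huv
  obtain ⟨x, hx, rfl⟩ := M.exists_measureReal_jobs_Iic_eq hu
  obtain ⟨y, hy, rfl⟩ := M.exists_measureReal_jobs_Iic_eq hv
  rw [M.jobQuantile_measureReal_jobs_Iic hx, M.jobQuantile_measureReal_jobs_Iic hy]
  exact (M.strictMonoOn_measureReal_jobs_Iic.lt_iff_lt hx hy).1 huv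

lemma continuousOn_jobQuantile : ContinuousOn M.jobQuantile (Icc 0 1) := by
  have hmaps : MapsTo M.jobQuantile (Icc 0 1) (Icc 0 1) := fun _ => M.jobQuantile_mem_Icc
  have hmono : Monotone (hmaps.restrict M.jobQuantile _ _) :=
    fun u v huv => M.strictMonoOn_jobQuantile.monotoneOn u.2 v.2 huv
  have hsurj : Function.Surjective (hmaps.restrict M.jobQuantile _ _) := fun x =>
    ⟨⟨M.jobs.real (Iic x), measureReal_nonneg, measureReal_le_one⟩,
      Subtype.ext (M.jobQuantile_measureReal_jobs_Iic x.2)⟩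
  exact continuousOn_iff_continuous_domRestrict.2
    (continuous_subtype_val.comp (hmono.continuous_of_surjective hsurj))

end Market

end Jobs

section Rank

variable (G : Measure ℝ)

lemma rank_eq_measureReal_Iic [NullSingletonClass G] (x t : ℝ) : rank G x t = G.real (Iic x) := by
  have : G.real (Iio x) = G.real (Iic x) := measureReal_congr Iio_ae_eq_Iic
  rw [rank, this]
  ring

variable {x y t : ℝ} (ht : t ∈ Icc (0 : ℝ) 1)

include ht

lemma rank_mem_Icc_measureReal [IsFiniteMeasure G] (x : ℝ) :
    rank G x t ∈ Icc (G.real (Iio x)) (G.real (Iic x)) := by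
  have : G.real (Iio x) ≤ G.real (Iic x) := measureReal_mono Iio_subset_Iic_self
  constructor <;> simp only [rank] <;> nlinarith [ht.1, ht.2]

lemma rank_mem_Icc [IsProbabilityMeasure G] (x : ℝ) : rank G x t ∈ Icc (0 : ℝ) 1 :=
  ⟨measureReal_nonneg.trans (rank_mem_Icc_measureReal G ht x).1,
    (rank_mem_Icc_measureReal G ht x).2.trans measureReal_le_one⟩

lemma monotone_rank [IsFiniteMeasure G] : Monotone fun x => rank G x t := fun _ _ hxy =>
  add_le_add
    (mul_le_mul_of_nonneg_left (measureReal_mono (Iio_subset_Iio hxy)) (sub_nonneg.2 ht.2))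
    (mul_le_mul_of_nonneg_left (measureReal_mono (Iic_subset_Iic.2 hxy)) ht.1)

end Rank

section Profile

namespace Market

variable {ι : Type*} [Fintype ι] (M : Market ι) {φ : ι → Kernel ℝ ℝ}

instance isProbabilityMeasure_ability (i : ι) : IsProbabilityMeasure (M.ability i) :=
  M.ability_prob i

lemma isProbabilityMeasure_sum_weight (μ : ι → Measure ℝ) [∀ i, IsProbabilityMeasure (μ i)] :
    IsProbabilityMeasure (∑ i, M.weight i • μ i) := by
  constructor
  simp only [Measure.coe_finsetSum, Finset.sum_apply, Measure.smul_apply, measure_univ,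
    ENNReal.smul_def, smul_eq_mul, mul_one]
  rw [← ENNReal.ofNNReal_finsetSum, M.sum_weight, ENNReal.coe_one]

lemma integral_sum_weight {μ : ι → Measure ℝ} {f : ℝ → ℝ} (hf : ∀ i, Integrable f (μ i)) :
    ∫ x, f x ∂(∑ i, M.weight i • μ i) = ∑ i, (M.weight i : ℝ) * ∫ x, f x ∂(μ i) := by
  rw [integral_finsetSum_measure fun i _ => (hf i).smul_measure_nnreal]
  simp [integral_smul_nnreal_measure, NNReal.smul_def]

lemma sum_weight_apply_eq_zero_iff (μ : ι → Measure ℝ) (s : Set ℝ) :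
    (∑ i, M.weight i • μ i) s = 0 ↔ ∀ i, μ i s = 0 := by
  simp only [Measure.coe_finsetSum, Finset.sum_apply, Finset.sum_eq_zero_iff, Finset.mem_univ,
    forall_const, Measure.smul_apply, ENNReal.smul_def, smul_eq_mul, mul_eq_zero,
    ENNReal.coe_eq_zero, (M.weight_pos _).ne', false_or]

instance nullSingletonClass_ability [NullSingletonClass M.aggregateAbility] (i : ι) :
    NullSingletonClass (M.ability i) :=
  ⟨fun x => (M.sum_weight_apply_eq_zero_iff M.ability {x}).1
    (measure_singleton (μ := M.aggregateAbility) x) i⟩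

lemma integrable_ability {f : ℝ → ℝ} (hf : Continuous f) (i : ι) : Integrable f (M.ability i) :=
  integrable_comp_of_ae_mem_Icc hf measurable_id (M.ability_supp i)

lemma integral_aggregateAbility {f : ℝ → ℝ} (hf : Continuous f) :
    ∫ a, f a ∂M.aggregateAbility = ∑ i, (M.weight i : ℝ) * ∫ a, f a ∂(M.ability i) :=
  M.integral_sum_weight (M.integrable_ability hf)

lemma isProfile_id : M.IsProfile fun _ => Kernel.id := fun i =>
  isTranscript_id (M.integrable_ability continuous_id i)

lemma aggregateGrade_id : (M.aggregateGrade fun _ => Kernel.id) = M.aggregateAbility := by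
  simp only [aggregateGrade, gradeDist_id, aggregateAbility]

lemma ae_aggregateGrade_iff {p : ℝ → Prop} :
    (∀ᵐ x ∂(M.aggregateGrade φ), p x) ↔ ∀ i, ∀ᵐ x ∂(gradeDist (M.ability i) (φ i)), p x :=
  M.sum_weight_apply_eq_zero_iff _ _

namespace IsProfile

variable {M} (hφ : M.IsProfile φ)

include hφ

lemma isProbabilityMeasure_gradeDist (i : ι) :
    IsProbabilityMeasure (gradeDist (M.ability i) (φ i)) := by
  have := (hφ i).markov
  infer_instance

lemma isProbabilityMeasure_aggregateGrade : IsProbabilityMeasure (M.aggregateGrade φ) := by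
  have := hφ.isProbabilityMeasure_gradeDist
  exact M.isProbabilityMeasure_sum_weight _

lemma ae_aggregateGrade_mem_Icc : ∀ᵐ x ∂(M.aggregateGrade φ), x ∈ Icc (0 : ℝ) 1 :=
  M.ae_aggregateGrade_iff.2 fun i => (hφ i).ae_gradeDist_mem_Icc (M.ability_supp i)

lemma integral_aggregateGrade {f : ℝ → ℝ} (hf : Continuous f) :
    ∫ x, f x ∂(M.aggregateGrade φ)
      = ∑ i, (M.weight i : ℝ) * ∫ x, f x ∂(gradeDist (M.ability i) (φ i)) := by
  have := hφ.isProbabilityMeasure_gradeDist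
  exact M.integral_sum_weight fun i => integrable_comp_of_ae_mem_Icc hf measurable_id
    ((hφ i).ae_gradeDist_mem_Icc (M.ability_supp i))

lemma integral_id_aggregateGrade :
    ∫ x, x ∂(M.aggregateGrade φ) = ∫ a, a ∂M.aggregateAbility := by
  rw [hφ.integral_aggregateGrade (f := fun x => x) continuous_id,
    M.integral_aggregateAbility (f := fun a => a) continuous_id]
  simp only [(hφ _).integral_id_gradeDist (M.integrable_ability continuous_id _)]

lemma support_aggregateGrade_subset : (M.aggregateGrade φ).support ⊆ Icc 0 1 :=
  Measure.support_subset_of_isClosed isClosed_Icc hφ.ae_aggregateGrade_mem_Icc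

lemma continuousOn_jobQuantile_rank (x : ℝ) :
    ContinuousOn (fun t => M.jobQuantile (rank (M.aggregateGrade φ) x t)) (Icc 0 1) := by
  have := hφ.isProbabilityMeasure_aggregateGrade
  refine M.continuousOn_jobQuantile.comp (Continuous.continuousOn ?_) fun t ht =>
    rank_mem_Icc _ ht _
  unfold rank
  fun_prop

lemma intervalIntegrable_jobQuantile_rank (x : ℝ) :
    IntervalIntegrable (fun t => M.jobQuantile (rank (M.aggregateGrade φ) x t)) volume 0 1 :=
  (hφ.continuousOn_jobQuantile_rank x).intervalIntegrable_of_Icc zero_le_one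

lemma monotone_desirability : Monotone (M.desirability φ) := by
  have := hφ.isProbabilityMeasure_aggregateGrade
  exact fun x y hxy => intervalIntegral.integral_mono_on zero_le_one
    (hφ.intervalIntegrable_jobQuantile_rank x) (hφ.intervalIntegrable_jobQuantile_rank y)
    fun t ht => M.strictMonoOn_jobQuantile.monotoneOn (rank_mem_Icc _ ht _) (rank_mem_Icc _ ht _)
      (monotone_rank _ ht hxy)

lemma desirability_mem_Icc (x : ℝ) : M.desirability φ x ∈ Icc (0 : ℝ) 1 := by
  have := hφ.isProbabilityMeasure_aggregateGrade
  have hmem : ∀ t ∈ Icc (0 : ℝ) 1, M.jobQuantile (rank (M.aggregateGrade φ) x t) ∈ Icc 0 1 :=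
    fun t ht => M.jobQuantile_mem_Icc (rank_mem_Icc _ ht x)
  refine ⟨intervalIntegral.integral_nonneg zero_le_one fun t ht => (hmem t ht).1, ?_⟩
  calc M.desirability φ x ≤ ∫ _ in (0 : ℝ)..1, (1 : ℝ) :=
        intervalIntegral.integral_mono_on zero_le_one (hφ.intervalIntegrable_jobQuantile_rank x)
          intervalIntegrable_const fun t ht => (hmem t ht).2
    _ = 1 := by simp

lemma jobQuantile_le_desirability_of_lt {x y : ℝ} (hxy : x < y) :
    M.jobQuantile ((M.aggregateGrade φ).real (Iic x)) ≤ M.desirability φ y := by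
  have := hφ.isProbabilityMeasure_aggregateGrade
  calc M.jobQuantile ((M.aggregateGrade φ).real (Iic x))
      = ∫ _ in (0 : ℝ)..1, M.jobQuantile ((M.aggregateGrade φ).real (Iic x)) := by simp
    _ ≤ M.desirability φ y := intervalIntegral.integral_mono_on zero_le_one
        intervalIntegrable_const (hφ.intervalIntegrable_jobQuantile_rank y) fun t ht =>
        M.strictMonoOn_jobQuantile.monotoneOn ⟨measureReal_nonneg, measureReal_le_one⟩
          (rank_mem_Icc _ ht _)
          ((measureReal_mono (Iic_subset_Iio.2 hxy)).trans (rank_mem_Icc_measureReal _ ht _).1)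

lemma desirability_lt_jobQuantile_of_atom {x : ℝ} (hx : M.aggregateGrade φ {x} ≠ 0) :
    M.desirability φ x < M.jobQuantile ((M.aggregateGrade φ).real (Iic x)) := by
  have := hφ.isProbabilityMeasure_aggregateGrade
  have hIic : (M.aggregateGrade φ).real (Iic x) ∈ Icc (0 : ℝ) 1 :=
    ⟨measureReal_nonneg, measureReal_le_one⟩
  have hjump : (M.aggregateGrade φ).real (Iio x) < (M.aggregateGrade φ).real (Iic x) := by
    rw [← Iio_union_right, measureReal_union (by simp) (measurableSet_singleton x)]
    exact lt_add_of_pos_right _ (ENNReal.toReal_pos hx (measure_ne_top _ _))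
  calc M.desirability φ x
      < ∫ _ in (0 : ℝ)..1, M.jobQuantile ((M.aggregateGrade φ).real (Iic x)) := by
        refine intervalIntegral.integral_lt_integral_of_continuousOn_of_le_of_exists_lt zero_lt_one
          (hφ.continuousOn_jobQuantile_rank x) continuousOn_const (fun t ht => ?_)
          ⟨0, left_mem_Icc.2 zero_le_one, ?_⟩
        · have ht := Ioc_subset_Icc_self ht
          exact M.strictMonoOn_jobQuantile.monotoneOn (rank_mem_Icc _ ht _) hIic
            (rank_mem_Icc_measureReal _ ht _).2
        · refine M.strictMonoOn_jobQuantile (rank_mem_Icc _ (left_mem_Icc.2 zero_le_one) _) hIic ?_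
          simpa [rank] using hjump
    _ = M.jobQuantile ((M.aggregateGrade φ).real (Iic x)) := by simp

lemma welfare_eq (hQ : Continuous (M.desirability φ)) :
    M.welfare id id φ = ∫ x, x * M.desirability φ x ∂(M.aggregateGrade φ) := by
  rw [hφ.integral_aggregateGrade (f := fun x => x * M.desirability φ x) (by fun_prop)]
  refine Finset.sum_congr rfl fun i _ => congrArg _ ?_
  have := (hφ i).markov
  have hint : Integrable (fun p : ℝ × ℝ => M.desirability φ p.2 * p.1) (M.ability i ⊗ₘ φ i) :=
    (integrable_fst_compProd (M.integrable_ability continuous_id i)).bdd_mul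
      (hQ.comp continuous_snd).aestronglyMeasurable (c := 1)
      (ae_of_all _ fun p => abs_le.2 ⟨by linarith [(hφ.desirability_mem_Icc p.2).1],
        (hφ.desirability_mem_Icc p.2).2⟩)
  have h := (hφ i).integral_mul_fst (M.integrable_ability continuous_id i) hQ.measurable hint
  simp only [mul_comm (M.desirability φ _)] at h
  exact h

end IsProfile

section NoAtoms

variable [NullSingletonClass (M.aggregateGrade φ)]

lemma desirability_eq_jobQuantile (x : ℝ) :
    M.desirability φ x = M.jobQuantile ((M.aggregateGrade φ).real (Iic x)) := by
  simp [desirability, rank_eq_measureReal_Iic]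

variable {M} (hφ : M.IsProfile φ)

include hφ

lemma IsProfile.continuous_desirability : Continuous (M.desirability φ) := by
  have := hφ.isProbabilityMeasure_aggregateGrade
  rw [funext M.desirability_eq_jobQuantile]
  exact M.continuousOn_jobQuantile.comp_continuous (continuous_measureReal_Iic _)
    fun x => ⟨measureReal_nonneg, measureReal_le_one⟩

lemma IsProfile.desirability_eq_zero {x : ℝ} (hx : x ≤ sInf (M.aggregateGrade φ).support) :
    M.desirability φ x = 0 := by
  have h0 : M.aggregateGrade φ (Iio x) = 0 := by
    refine measure_mono_null (t := (M.aggregateGrade φ).supportᶜ) (fun y hy hy' => ?_)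
      Measure.measure_compl_support
    exact (hy.trans_le hx).not_ge
      (csInf_le ⟨0, fun z hz => (hφ.support_aggregateGrade_subset hz).1⟩ hy')
  rw [M.desirability_eq_jobQuantile, measureReal_def, ← measure_congr Iio_ae_eq_Iic, h0,
    ENNReal.toReal_zero, M.jobQuantile_zero]

end NoAtoms

lemma truthfulWelfare_eq (huniform : M.aggregateAbility = volume.restrict (Icc 0 1)) :
    M.truthfulWelfare id id = ∫ u in (0 : ℝ)..1, u * M.jobQuantile u := by
  have hgrade := M.aggregateGrade_id.trans huniform
  have : NullSingletonClass (M.aggregateGrade fun _ => Kernel.id) := by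
    rw [hgrade]
    infer_instance
  rw [truthfulWelfare, M.isProfile_id.welfare_eq M.isProfile_id.continuous_desirability, hgrade,
    intervalIntegral.integral_of_le zero_le_one, ← integral_Icc_eq_integral_Ioc]
  refine setIntegral_congr_fun measurableSet_Icc fun u hu => ?_
  have hinter : Iic u ∩ Icc 0 1 = Icc 0 u := by
    ext x
    exact ⟨fun hx => ⟨hx.2.1, hx.1⟩, fun hx => ⟨hx.2, hx.1, hx.2.trans hu.2⟩⟩
  have hcdf : (volume.restrict (Icc (0 : ℝ) 1)).real (Iic u) = u := by
    rw [measureReal_restrict_apply measurableSet_Iic, hinter, Real.volume_real_Icc_of_le hu.1,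
      sub_zero]
  simp only [M.desirability_eq_jobQuantile, hgrade, hcdf]

end Market

end Profile

section Equilibrium

namespace Market

variable {ι : Type*} [Fintype ι] {M : Market ι} {φ : ι → Kernel ℝ ℝ}

/-- The highest grade produced under `φ`, i.e. the essential supremum of the grades. -/
noncomputable def topGrade (M : Market ι) (φ : ι → Kernel ℝ ℝ) : ℝ :=
  sSup (M.aggregateGrade φ).support

namespace IsProfile

variable (hφ : M.IsProfile φ)

include hφ

lemma topGrade_nonneg : 0 ≤ M.topGrade φ :=
  Real.sSup_nonneg fun _ hx => (hφ.support_aggregateGrade_subset hx).1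

lemma ae_le_topGrade : ∀ᵐ x ∂(M.aggregateGrade φ), x ≤ M.topGrade φ := by
  filter_upwards [Measure.support_mem_ae] with x hx
  exact le_csSup ⟨1, fun y hy => (hφ.support_aggregateGrade_subset hy).2⟩ hx

end IsProfile

namespace IsEquilibrium

variable (h : M.IsEquilibrium φ)

include h

lemma isBestResponse (i : ι) : IsBestResponse (M.desirability φ) (M.ability i) (φ i) :=
  ⟨h.1 i, h.2 i⟩

lemma integral_desirability_ability_le (i : ι) :
    ∫ a, M.desirability φ a ∂(M.ability i)
      ≤ ∫ x, M.desirability φ x ∂(gradeDist (M.ability i) (φ i)) := by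
  simpa only [gradeDist_id] using h.2 i Kernel.id (M.isProfile_id i)

variable [NullSingletonClass M.aggregateAbility]

lemma nullSingletonClass_gradeDist (i : ι) :
    NullSingletonClass (gradeDist (M.ability i) (φ i)) := by
  refine ⟨fun x => ?_⟩
  by_cases hx : M.aggregateGrade φ {x} = 0
  · exact (M.sum_weight_apply_eq_zero_iff _ {x}).1 hx i
  · exact (h.isBestResponse i).gradeDist_singleton_eq_zero (M.integrable_ability continuous_id i)
      h.1.monotone_desirability.measurable h.1.desirability_mem_Icc
      (h.1.desirability_lt_jobQuantile_of_atom hx)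
      fun y hy => h.1.jobQuantile_le_desirability_of_lt hy

lemma nullSingletonClass_aggregateGrade : NullSingletonClass (M.aggregateGrade φ) := by
  have := h.nullSingletonClass_gradeDist
  exact ⟨fun x => (M.sum_weight_apply_eq_zero_iff _ {x}).2 fun i => measure_singleton x⟩

lemma continuous_desirability : Continuous (M.desirability φ) :=
  have := h.nullSingletonClass_aggregateGrade
  h.1.continuous_desirability

lemma two_mul_desirability_le (i : ι) {y z : ℝ} (hyz : y ≠ z)
    (hy : y ∈ (gradeDist (M.ability i) (φ i)).support)
    (hz : z ∈ (gradeDist (M.ability i) (φ i)).support) :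
    2 * M.desirability φ ((y + z) / 2) ≤ M.desirability φ y + M.desirability φ z := by
  have := h.nullSingletonClass_gradeDist i
  have := h.1.isProbabilityMeasure_gradeDist i
  have hQ := h.continuous_desirability
  exact two_mul_le_add_of_mem_support hQ (fun B c hB hc =>
    (h.isBestResponse i).mul_le_setIntegral (M.integrable_ability continuous_id i)
      hQ.measurable h.1.desirability_mem_Icc hB hc) hyz hy hz

lemma convexOn_desirability (hconn : M.IsConnected φ) :
    ConvexOn ℝ (Iic (M.topGrade φ)) (M.desirability φ) := by
  have := h.nullSingletonClass_aggregateGrade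
  refine convexOn_of_frequently_midpoint_le (convex_Iic _) h.continuous_desirability.continuousOn
    fun x hx => Eventually.frequently ?_
  rw [interior_Iic] at hx
  rcases le_or_gt x (sInf (M.aggregateGrade φ).support) with hx' | hx'
  · refine Eventually.of_forall fun δ => ?_
    rw [h.1.desirability_eq_zero hx']
    linarith [(h.1.desirability_mem_Icc (x - δ)).1, (h.1.desirability_mem_Icc (x + δ)).1]
  · obtain ⟨i, ε, hε, hsub⟩ := hconn x ⟨hx', hx⟩
    filter_upwards [Ioo_mem_nhdsGT hε] with δ hδ
    have hmid := h.two_mul_desirability_le i (y := x - δ) (z := x + δ) (by linarith [hδ.1])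
      (hsub ⟨by linarith [hδ.2], by linarith [hδ.1]⟩)
      (hsub ⟨by linarith [hδ.1], by linarith [hδ.2]⟩)
    rwa [sub_add_add_cancel, add_self_div_two] at hmid

lemma exists_convexOn_extendLine (hconn : M.IsConnected φ) {i : ι}
    (hi : M.ability i (Ioi (M.topGrade φ)) ≠ 0) :
    ∃ s, (∀ᶠ x in 𝓝[<] M.topGrade φ,
        M.desirability φ x = M.desirability φ (M.topGrade φ) + s * (x - M.topGrade φ)) ∧
      ConvexOn ℝ univ (extendLine (M.desirability φ) (M.topGrade φ) s) ∧
      ∫ a, extendLine (M.desirability φ) (M.topGrade φ) s a ∂(M.ability i)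
        ≤ ∫ x, M.desirability φ x ∂(gradeDist (M.ability i) (φ i)) :=
  have := h.nullSingletonClass_gradeDist i
  (h.isBestResponse i).exists_convexOn_extendLine (M.ability_supp i) h.continuous_desirability
    h.1.desirability_mem_Icc (h.convexOn_desirability hconn)
    (M.ae_aggregateGrade_iff.1 h.1.ae_le_topGrade i) h.1.topGrade_nonneg hi

lemma exists_forall_integral_extendLine_le (hconn : M.IsConnected φ)
    (hpos : M.aggregateAbility (Ioi (M.topGrade φ)) ≠ 0) :
    ∃ s ≥ 0, ConvexOn ℝ univ (extendLine (M.desirability φ) (M.topGrade φ) s) ∧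
      ∀ i, ∫ a, extendLine (M.desirability φ) (M.topGrade φ) s a ∂(M.ability i)
        ≤ ∫ x, M.desirability φ x ∂(gradeDist (M.ability i) (φ i)) := by
  set b := M.topGrade φ
  obtain ⟨j, hj⟩ := not_forall.1 fun h0 => hpos ((M.sum_weight_apply_eq_zero_iff _ _).2 h0)
  obtain ⟨s, hs, hconv, -⟩ := h.exists_convexOn_extendLine hconn hj
  refine ⟨s, ?_, hconv, fun i => ?_⟩
  · obtain ⟨x, hx, hxb⟩ := (hs.and self_mem_nhdsWithin).exists
    have hxb : x < b := hxb
    have := h.1.monotone_desirability hxb.le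
    exact nonneg_of_mul_nonpos_left (by linarith) (sub_neg.2 hxb)
  by_cases hi : M.ability i (Ioi b) = 0
  · refine (integral_congr_ae ?_).trans_le (h.integral_desirability_ability_le i)
    filter_upwards [measure_eq_zero_iff_ae_notMem.1 hi] with a ha
      using extendLine_of_le (not_lt.1 ha)
  · obtain ⟨s', hs', -, hint⟩ := h.exists_convexOn_extendLine hconn hi
    -- both slopes are the left derivative of the desirability at the top grade
    obtain ⟨x, ⟨hx, hx'⟩, hxb⟩ := ((hs.and hs').and self_mem_nhdsWithin).exists
    have hss : s = s' := mul_right_cancel₀ (sub_neg.2 hxb).ne (add_left_cancel (hx.symm.trans hx'))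
    rwa [hss]

end IsEquilibrium

lemma IsEquilibrium.exists_convexOn_eq_desirability (h : M.IsEquilibrium φ)
    (huniform : M.aggregateAbility = volume.restrict (Icc 0 1)) (hconn : M.IsConnected φ) :
    ∃ P : ℝ → ℝ, Continuous P ∧ Monotone P ∧ (∀ x, 0 ≤ P x) ∧ ConvexOn ℝ (Icc 0 1) P ∧
      (∀ x ≤ M.topGrade φ, P x = M.desirability φ x) ∧
      ∀ i, ∫ a, P a ∂(M.ability i)
        ≤ ∫ x, M.desirability φ x ∂(gradeDist (M.ability i) (φ i)) := by
  have : NullSingletonClass M.aggregateAbility := huniform ▸ inferInstance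
  have hQ := h.continuous_desirability
  have hmono := h.1.monotone_desirability
  have hnonneg : ∀ x, 0 ≤ M.desirability φ x := fun x => (h.1.desirability_mem_Icc x).1
  rcases le_or_gt 1 (M.topGrade φ) with h1 | h1
  · exact ⟨M.desirability φ, hQ, hmono, hnonneg,
      (h.convexOn_desirability hconn).subset (fun x hx => hx.2.trans h1) (convex_Icc 0 1),
      fun _ _ => rfl, h.integral_desirability_ability_le⟩
  · have hpos : M.aggregateAbility (Ioi (M.topGrade φ)) ≠ 0 := by
      rw [huniform, Measure.restrict_apply measurableSet_Ioi]
      have hsub : Ioc (M.topGrade φ) 1 ⊆ Ioi (M.topGrade φ) ∩ Icc 0 1 := fun x hx =>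
        ⟨hx.1, h.1.topGrade_nonneg.trans hx.1.le, hx.2⟩
      intro h0
      have hvol := measure_mono_null hsub h0
      rw [Real.volume_Ioc, ENNReal.ofReal_eq_zero] at hvol
      linarith
    obtain ⟨s, hs, hconv, hint⟩ := h.exists_forall_integral_extendLine_le hconn hpos
    refine ⟨extendLine (M.desirability φ) (M.topGrade φ) s, continuous_extendLine hQ _ s,
      monotone_extendLine hmono _ hs, fun x => ?_,
      hconv.subset (subset_univ _) (convex_Icc 0 1), fun x hx => extendLine_of_le hx, hint⟩
    exact add_nonneg (hnonneg _) (mul_nonneg hs (sub_nonneg.2 (min_le_left _ _)))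

lemma IsEquilibrium.truthfulWelfare_le (h : M.IsEquilibrium φ)
    (huniform : M.aggregateAbility = volume.restrict (Icc 0 1)) (hconn : M.IsConnected φ) :
    M.truthfulWelfare id id ≤ 1.36 * M.welfare id id φ := by
  have : NullSingletonClass M.aggregateAbility := huniform ▸ inferInstance
  have := h.nullSingletonClass_aggregateGrade
  have := h.1.isProbabilityMeasure_aggregateGrade
  have huniform' (f : ℝ → ℝ) : ∫ a, f a ∂M.aggregateAbility = ∫ u in (0 : ℝ)..1, f u := by
    rw [huniform, intervalIntegral.integral_of_le zero_le_one, integral_Icc_eq_integral_Ioc]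
  obtain ⟨P, hPc, hPm, hP0, hPconv, hPQ, hPint⟩ :=
    h.exists_convexOn_eq_desirability huniform hconn
  have hae : ∀ᵐ x ∂(M.aggregateGrade φ), P x = M.desirability φ x := h.1.ae_le_topGrade.mono hPQ
  have hmean : ∫ x, x ∂(M.aggregateGrade φ) = 1 / 2 := by
    rw [h.1.integral_id_aggregateGrade, huniform' fun a => a]
    simp
  have hint : ∫ x in (0 : ℝ)..1, P x ≤ ∫ x, P x ∂(M.aggregateGrade φ) := by
    rw [integral_congr_ae hae, ← huniform', M.integral_aggregateAbility hPc,
      h.1.integral_aggregateGrade h.continuous_desirability]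
    exact Finset.sum_le_sum fun i _ => mul_le_mul_of_nonneg_left (hPint i) (M.weight i).2
  calc M.truthfulWelfare id id
      = ∫ u in (0 : ℝ)..1, u * M.jobQuantile u := M.truthfulWelfare_eq huniform
    _ ≤ 1.36 * ∫ x, x * P x ∂(M.aggregateGrade φ) :=
        integral_mul_le_of_convexOn h.1.ae_aggregateGrade_mem_Icc hmean hPc hPm
          (fun x _ => hP0 x) hPconv hint M.continuousOn_jobQuantile
          (hae.mono fun x hx => hx.trans (M.desirability_eq_jobQuantile x))
    _ = 1.36 * ∫ x, x * M.desirability φ x ∂(M.aggregateGrade φ) := by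
        rw [integral_congr_ae (hae.mono fun x hx => congrArg (x * ·) hx)]
    _ = 1.36 * M.welfare id id φ := by rw [h.1.welfare_eq h.continuous_desirability]

end Market

end Equilibrium

end Grading

theorem theorem4p2 {ι : Type*} [Fintype ι] (M : Grading.Market ι)
    (huniform : M.aggregateAbility = volume.restrict (Set.Icc 0 1)) :
    M.priceOfAnarchy id id ≤ ENNReal.ofReal 1.36 := by
  refine iSup_le fun φ => iSup_le fun h => iSup_le fun hconn => ?_
  refine ENNReal.div_le_of_le_mul ?_
  rw [← ENNReal.ofReal_mul (by norm_num)]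
  exact ENNReal.ofReal_le_ofReal (h.truthfulWelfare_le huniform hconn)
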